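/- **Theorem.** Let $\mathfrak S_n$ be the set of permutations of $[n]=\{1,\dots,n\}$. For $\tau\in\mathfrak S_n$ and $\pi\in\mathfrak S_r$, let $X_\pi(\tau)$ be the number of subsets $I=\{i_1<\dots<i_r\}$ of $[n]$ such that, for all $j,k\in[r]$, $\pi(j)>\pi(k)$ if and only if $\tau(i_j)>\tau(i_k)$. A cycle type of size $n$ is a sequence $t=(t_1,\dots,t_n)$ of nonnegative integers with $\sum_{p=1}^n p\,t_p=n$; a uniform $t$-cyclic permutation is a uniformly random element of the set of permutations of $[n]$ having exactly $t_p$ cycles of length $p$ for each $p$ (fixed points being the cycles of length $1$). Let $d_K$ denote the Kolmogorov distance between probability distributions on $\mathbb R$, i.e. the supremum distance between their distribution functions, and let $Y\sim\mathcal N(0,1)$. For each $n$, let $t^{(n)}$ be a cycle type of size $n$ and let $\tau_n$ be a uniform $t^{(n)}$-cyclic permutation. Fix an integer $r\ge 1$ and $\pi\in\mathfrak S_r$. Then for every $n$ such that $\mathrm{Var}(X_\pi(\tau_n))>0$, $$ d_K\!\left(\frac{X_\pi(\tau_n)-\mathbb E[X_\pi(\tau_n)]}{\sqrt{\mathrm{Var}(X_\pi(\tau_n))}},\,Y\right)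 \le 42\,\frac{r}{(r-1)!^2}\,\frac{n^{2r-3/2}}{\mathrm{Var}(X_\pi(\tau_n))} +72\,\frac{r}{(r-1)!^3}\,\frac{n^{3r-2}}{\mathrm{Var}(X_\pi(\tau_n))^{3/2}} . $$ Furthermore, if $\mathrm{Var}(X_\pi(\tau_n))=\sigma^2n^{2r-1}+o(n^{2r-1})$ as $n\to\infty$ for some $\sigma\ge 0$, then $$ \frac{X_\pi(\tau_n)-\mathbb E[X_\pi(\tau_n)]}{n^{r-1/2}}\longrightarrow\mathcal N(0,\sigma^2) $$ in distribution as $n\to\infty$ (where $\mathcal N(0,0)$ is the Dirac mass at $0$), and if moreover $\sigma>0$ then $$ d_K\!\left(\frac{X_\pi(\tau_n)-\mathbb E[X_\pi(\tau_n)]}{\sqrt{\mathrm{Var}(X_\pi(\tau_n))}},\,Y\right)=O(n^{-1/2}) . $$ -/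

import Mathlib

open MeasureTheory ProbabilityTheory Filter Asymptotics

noncomputable section

/-- The discrete σ-algebra on the finite set of permutations of `[n]`. -/
instance permMeasurableSpace (n : ℕ) : MeasurableSpace (Equiv.Perm (Fin n)) := ⊤

instance permDiscreteMeasurableSpace (n : ℕ) :
    DiscreteMeasurableSpace (Equiv.Perm (Fin n)) := ⟨fun _ => trivial⟩

/-- A cycle type of size `n` is a partition `t` of `n`; the number `t_p` of `p`-cycles
(fixed points included, for `p = 1`) is the multiplicity of `p` in `t.parts`.
A permutation of `[n]` is `t`-cyclic if for every `p` it has exactly `t_p` cycles of length `p`. -/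
def IsCyclicOfType {n : ℕ} (t : n.Partition) (τ : Equiv.Perm (Fin n)) : Prop :=
  τ.partition.parts = t.parts

/-- `τ` is a uniformly random `t`-cyclic permutation under `P`. -/
def IsUniformCyclic {n : ℕ} (t : n.Partition) {Ω : Type*} [MeasurableSpace Ω]
    (τ : Ω → Equiv.Perm (Fin n)) (P : Measure Ω) : Prop :=
  HasLaw τ (uniformOn {ρ : Equiv.Perm (Fin n) | IsCyclicOfType t ρ}) P

/-- `pat(I, τ) = π`: the set `I = {i_0 < ⋯ < i_{r-1}}` has size `r`, and
`π j > π k` iff `τ (i_j) > τ (i_k)` for all `j, k`. -/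
def InducesPattern {n r : ℕ} (I : Finset (Fin n)) (τ : Equiv.Perm (Fin n))
    (π : Equiv.Perm (Fin r)) : Prop :=
  ∃ h : I.card = r, ∀ j k : Fin r,
    π j > π k ↔ τ (I.orderEmbOfFin h j) > τ (I.orderEmbOfFin h k)

open Classical in
/-- The pattern count `X_π(τ)`: the number of `r`-element subsets `I` of `[n]` on which `τ`
induces the pattern `π`. -/
def patternCount {n r : ℕ} (π : Equiv.Perm (Fin r)) (τ : Equiv.Perm (Fin n)) : ℕ :=
  ∑ I ∈ (Finset.univ : Finset (Fin n)).powersetCard r, if InducesPattern I τ π then 1 else 0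

/-- The Kolmogorov distance `sup_x |μ((-∞, x]) - ν((-∞, x])|` of two probability measures
on the real line. -/
def kolmogorovDist (μ ν : Measure ℝ) : ℝ :=
  ⨆ x : ℝ, |μ.real (Set.Iic x) - ν.real (Set.Iic x)|

end

/-!
Fix a permutation `ρ` of the given cycle type. If `U₁, …, Uₙ` are i.i.d. with an atomless law, the
permutation `s` sending each index to the rank of its variable is uniform, so `s * ρ * s⁻¹` is
uniform in the conjugacy class of `ρ`. Hence `X_π` has the law of the number of occurrences of `π`
among the points `(Uᵢ, U_{ρ i})`, a sum of indicators `h_I(U)` over the `r`-subsets `I` of `[n]`,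
where `h_I` depends only on the at most `2r` coordinates in `I ∪ ρ(I)` and each coordinate affects
at most `2 * (n - 1).choose (r - 1)` of the sets `I`.

For such a function `W` of independent coordinates, replacing the coordinates one after the other by
an independent copy writes the covariance of `W` with `f(W)` as a sum of products of increments.
Inserted into Stein's equation for a half-line, this leaves the fluctuations of a variance
estimator, which Efron–Stein controls, and a remainder in which `f'` is an increment of
`w ↦ w f(w)`. As that function is monotone, the remainder is again a mean-zero fluctuation of the
same order, so that the bound on the Kolmogorov distance consists of a single term.
-/

section SteinEquation

open Set Real
open scoped Topology

local notation "φ" => gaussianPDFReal 0 1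

local notation "Φ" => cdf (gaussianReal 0 1)

lemma gaussianPDFReal_zero_one (x : ℝ) : φ x = (√(2 * π))⁻¹ * exp (-(1 / 2) * x ^ 2) := by
  simp only [gaussianPDFReal, NNReal.coe_one, mul_one, sub_zero]
  congr 2
  ring

lemma integrable_pow_mul_gaussianPDFReal (k : ℕ) : Integrable fun x => x ^ k * φ x := by
  have h := integrable_rpow_mul_exp_neg_mul_sq (b := 1 / 2) (by norm_num) (s := k)
    (neg_one_lt_zero.trans_le k.cast_nonneg)
  refine (h.const_mul (√(2 * π))⁻¹).congr (ae_of_all _ fun x => ?_)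
  simp only [gaussianPDFReal_zero_one, rpow_natCast]
  ring

lemma integrable_mul_gaussianPDFReal : Integrable fun x => x * φ x := by
  simpa only [pow_one] using integrable_pow_mul_gaussianPDFReal 1

lemma hasDerivAt_gaussianPDFReal (x : ℝ) : HasDerivAt φ (-x * φ x) x := by
  have h : HasDerivAt (fun x : ℝ => -(1 / 2) * x ^ 2) (-x) x :=
    ((hasDerivAt_pow 2 x).const_mul _).congr_deriv (by norm_num; ring)
  simp only [funext gaussianPDFReal_zero_one]
  exact (h.exp.const_mul _).congr_deriv (by ring)

lemma gaussianReal_cdf_eq_setIntegral (w : ℝ) : Φ w = ∫ x in Iic w, φ x := by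
  rw [cdf_eq_real, measureReal_def, gaussianReal_apply_eq_integral _ one_ne_zero,
    ENNReal.toReal_ofReal (setIntegral_nonneg measurableSet_Iic
      fun _ _ => gaussianPDFReal_nonneg _ _ _)]

lemma hasDerivAt_gaussianReal_cdf (w : ℝ) : HasDerivAt Φ (φ w) w := by
  have hc : Continuous φ :=
    continuous_iff_continuousAt.2 fun x => (hasDerivAt_gaussianPDFReal x).continuousAt
  have hi := integrable_gaussianPDFReal 0 1
  have h : ⇑Φ = fun w => Φ 0 + ∫ x in (0 : ℝ)..w, φ x := by
    funext w
    rw [← intervalIntegral.integral_Iic_sub_Iic hi.integrableOn hi.integrableOn,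
      gaussianReal_cdf_eq_setIntegral, gaussianReal_cdf_eq_setIntegral, add_sub_cancel]
  rw [h]
  exact (intervalIntegral.integral_hasDerivAt_right (hc.intervalIntegrable _ _)
    (hc.stronglyMeasurableAtFilter _ _) hc.continuousAt).const_add _

lemma gaussianReal_cdf_add_cdf_neg (w : ℝ) : Φ w + Φ (-w) = 1 := by
  have h : ∫ x in Iic (-w), φ x = ∫ x in Ioi w, φ x := by
    rw [← integral_comp_neg_Ioi]
    simp only [gaussianPDFReal_zero_one, neg_sq]
  rw [gaussianReal_cdf_eq_setIntegral, gaussianReal_cdf_eq_setIntegral, h, ← compl_Iic,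
    integral_add_compl measurableSet_Iic (integrable_gaussianPDFReal 0 1),
    integral_gaussianPDFReal_eq_one 0 one_ne_zero]

lemma setIntegral_Iic_mul_gaussianPDFReal (w : ℝ) : ∫ x in Iic w, x * φ x = -φ w := by
  have hd : ∀ x, HasDerivAt (fun x => -φ x) (x * φ x) x := fun x =>
    (hasDerivAt_gaussianPDFReal x).fun_neg.congr_deriv (by ring)
  rw [integral_Iic_of_hasDerivAt_of_tendsto' (fun x _ => hd x)
    integrable_mul_gaussianPDFReal.integrableOn
    (tendsto_zero_of_hasDerivAt_of_integrableOn_Iic (a := 0) (fun x _ => hd x)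
      integrable_mul_gaussianPDFReal.integrableOn
      (integrable_gaussianPDFReal 0 1).neg.integrableOn), sub_zero]

lemma setIntegral_Iic_sq_mul_gaussianPDFReal (w : ℝ) :
    ∫ x in Iic w, x ^ 2 * φ x = Φ w - w * φ w := by
  have hd : ∀ x, HasDerivAt (fun x => x * φ x) (φ x - x ^ 2 * φ x) x := fun x =>
    ((hasDerivAt_id' x).mul (hasDerivAt_gaussianPDFReal x)).congr_deriv (by ring)
  have h0 := integrable_gaussianPDFReal 0 1
  have h2 := integrable_pow_mul_gaussianPDFReal 2
  have h : ∫ x in Iic w, (φ x - x ^ 2 * φ x) = w * φ w := by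
    rw [integral_Iic_of_hasDerivAt_of_tendsto' (fun x _ => hd x) (h0.sub h2).integrableOn
      (tendsto_zero_of_hasDerivAt_of_integrableOn_Iic (a := 0) (fun x _ => hd x)
        (h0.sub h2).integrableOn integrable_mul_gaussianPDFReal.integrableOn), sub_zero]
  rw [integral_sub h0.integrableOn h2.integrableOn, ← gaussianReal_cdf_eq_setIntegral] at h
  linarith

lemma mul_gaussianReal_cdf_add_pdf_nonneg (w : ℝ) : 0 ≤ w * Φ w + φ w := by
  have h : ∫ x in Iic w, (w - x) * φ x = w * Φ w + φ w := by
    simp only [sub_mul]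
    rw [integral_sub ((integrable_gaussianPDFReal 0 1).const_mul w).integrableOn
      integrable_mul_gaussianPDFReal.integrableOn, setIntegral_Iic_mul_gaussianPDFReal,
      integral_const_mul, ← gaussianReal_cdf_eq_setIntegral, sub_neg_eq_add]
  rw [← h]
  exact setIntegral_nonneg measurableSet_Iic fun x hx =>
    mul_nonneg (sub_nonneg.2 hx) (gaussianPDFReal_nonneg _ _ _)

lemma one_add_sq_mul_gaussianReal_cdf_add_nonneg (w : ℝ) : 0 ≤ (1 + w ^ 2) * Φ w + w * φ w := by
  have h0 := integrable_gaussianPDFReal 0 1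
  have h1 := integrable_mul_gaussianPDFReal
  have h2 := integrable_pow_mul_gaussianPDFReal 2
  have h : ∫ x in Iic w, (w - x) ^ 2 * φ x = (1 + w ^ 2) * Φ w + w * φ w := by
    have hexpand : ∀ x, (w - x) ^ 2 * φ x =
        w ^ 2 * φ x - 2 * w * (x * φ x) + x ^ 2 * φ x := fun x => by ring
    simp only [hexpand]
    have h01 : Integrable fun x => w ^ 2 * φ x - 2 * w * (x * φ x) :=
      (h0.const_mul _).sub (h1.const_mul _)
    rw [integral_add h01.integrableOn h2.integrableOn,
      integral_sub (h0.const_mul _).integrableOn (h1.const_mul _).integrableOn,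
      integral_const_mul, integral_const_mul, ← gaussianReal_cdf_eq_setIntegral,
      setIntegral_Iic_mul_gaussianPDFReal, setIntegral_Iic_sq_mul_gaussianPDFReal]
    ring
  rw [← h]
  exact setIntegral_nonneg measurableSet_Iic fun x _ =>
    mul_nonneg (sq_nonneg _) (gaussianPDFReal_nonneg _ _ _)

/-- The ratio of the standard Gaussian lower tail to the density, i.e. Mills' ratio at `-w`. -/
noncomputable def millsRatio (w : ℝ) : ℝ := Φ w / φ w

lemma millsRatio_mul_gaussianPDFReal (w : ℝ) : millsRatio w * φ w = Φ w :=
  div_mul_cancel₀ _ (gaussianPDFReal_pos 0 1 w one_ne_zero).ne'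

lemma hasDerivAt_millsRatio (w : ℝ) : HasDerivAt millsRatio (w * millsRatio w + 1) w := by
  have hφ := (gaussianPDFReal_pos 0 1 w one_ne_zero).ne'
  refine ((hasDerivAt_gaussianReal_cdf w).div (hasDerivAt_gaussianPDFReal w) hφ).congr_deriv ?_
  rw [millsRatio]
  field_simp
  ring

lemma neg_one_le_mul_millsRatio (w : ℝ) : -1 ≤ w * millsRatio w := by
  have hφ := gaussianPDFReal_pos 0 1 w one_ne_zero
  rw [millsRatio, mul_div_assoc', le_div_iff₀ hφ]
  linarith [mul_gaussianReal_cdf_add_pdf_nonneg w]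

lemma monotone_mul_millsRatio : Monotone fun w => w * millsRatio w := by
  have hd : ∀ w, HasDerivAt (fun w => w * millsRatio w)
      (1 * millsRatio w + w * (w * millsRatio w + 1)) w := fun w =>
    (hasDerivAt_id w).mul (hasDerivAt_millsRatio w)
  refine monotone_of_hasDerivAt_nonneg hd fun w => ?_
  refine nonneg_of_mul_nonneg_left ?_ (gaussianPDFReal_pos 0 1 w one_ne_zero)
  linear_combination one_add_sq_mul_gaussianReal_cdf_add_nonneg w
    - (1 + w ^ 2) * millsRatio_mul_gaussianPDFReal w

/-- The bounded solution `f` of Stein's equation `f' w - w f w = 1_{w ≤ z} - Φ z`. -/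
noncomputable def steinSol (z w : ℝ) : ℝ :=
  if w ≤ z then (1 - Φ z) * millsRatio w else Φ z * millsRatio (-w)

lemma one_sub_cdf_mul_millsRatio_self (z : ℝ) :
    (1 - Φ z) * millsRatio z = Φ z * millsRatio (-z) := by
  have hneg : φ (-z) = φ z := by simp only [gaussianPDFReal_zero_one, neg_sq]
  rw [← eq_sub_of_add_eq' (gaussianReal_cdf_add_cdf_neg z), millsRatio, millsRatio, hneg]
  ring

lemma steinSol_of_le {z w : ℝ} (h : w ≤ z) : steinSol z w = (1 - Φ z) * millsRatio w := if_pos h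

lemma steinSol_of_ge {z w : ℝ} (h : z ≤ w) : steinSol z w = Φ z * millsRatio (-w) := by
  rcases h.eq_or_lt with rfl | h
  · rw [steinSol_of_le le_rfl, one_sub_cdf_mul_millsRatio_self]
  · exact if_neg h.not_ge

lemma continuous_steinSol (z : ℝ) : Continuous (steinSol z) := by
  have hM : Continuous millsRatio :=
    continuous_iff_continuousAt.2 fun w => (hasDerivAt_millsRatio w).continuousAt
  refine Continuous.if_le (by fun_prop) (by fun_prop) continuous_id continuous_const ?_
  rintro w rfl
  exact one_sub_cdf_mul_millsRatio_self _

lemma monotone_mul_steinSol (z : ℝ) : Monotone fun w => w * steinSol z w := by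
  refine MonotoneOn.Iic_union_Ici (a := z) (fun a ha b hb hab => ?_) fun a ha b hb hab => ?_
  · have := mul_le_mul_of_nonneg_left (monotone_mul_millsRatio hab)
      (sub_nonneg.2 (cdf_le_one (gaussianReal 0 1) z))
    simp only [steinSol_of_le (mem_Iic.1 ha), steinSol_of_le (mem_Iic.1 hb)] at this ⊢
    linarith
  · have := mul_le_mul_of_nonneg_left (monotone_mul_millsRatio (neg_le_neg hab))
      (cdf_nonneg (gaussianReal 0 1) z)
    simp only [steinSol_of_ge (mem_Ici.1 ha), steinSol_of_ge (mem_Ici.1 hb)] at this ⊢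
    linarith

lemma cdf_sub_one_le_mul_steinSol (z w : ℝ) : Φ z - 1 ≤ w * steinSol z w := by
  refine le_trans ?_ (monotone_mul_steinSol z (min_le_left w z))
  have := mul_le_mul_of_nonneg_left (neg_one_le_mul_millsRatio (min w z))
    (sub_nonneg.2 (cdf_le_one (gaussianReal 0 1) z))
  simp only [steinSol_of_le (min_le_right w z)]
  linarith

lemma mul_steinSol_le_cdf (z w : ℝ) : w * steinSol z w ≤ Φ z := by
  refine (monotone_mul_steinSol z (le_max_left w z)).trans ?_
  have := mul_le_mul_of_nonneg_left (neg_one_le_mul_millsRatio (-max w z))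
    (cdf_nonneg (gaussianReal 0 1) z)
  simp only [steinSol_of_ge (le_max_right w z)]
  linarith

lemma abs_mul_steinSol_le_one (z w : ℝ) : |w * steinSol z w| ≤ 1 := by
  have := cdf_sub_one_le_mul_steinSol z w
  have := mul_steinSol_le_cdf z w
  have := cdf_nonneg (gaussianReal 0 1) z
  have := cdf_le_one (gaussianReal 0 1) z
  exact abs_le.2 ⟨by linarith, by linarith⟩

lemma exists_abs_steinSol_le (z : ℝ) : ∃ C, ∀ w, |steinSol z w| ≤ C := by
  obtain ⟨C, hC⟩ := isCompact_Icc.exists_bound_of_continuousOn (s := Icc (-1 : ℝ) 1)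
    (continuous_steinSol z).continuousOn
  refine ⟨max C 1, fun w => ?_⟩
  rcases le_total |w| 1 with hw | hw
  · exact (hC w (abs_le.1 hw)).trans (le_max_left _ _)
  · calc |steinSol z w| ≤ |w| * |steinSol z w| := le_mul_of_one_le_left (abs_nonneg _) hw
      _ = |w * steinSol z w| := (abs_mul _ _).symm
      _ ≤ max C 1 := (abs_mul_steinSol_le_one z w).trans (le_max_right _ _)

lemma hasDerivWithinAt_steinSol (z w : ℝ) :
    HasDerivWithinAt (steinSol z)
      (w * steinSol z w + (if w < z then 1 else 0) - Φ z) (Ici w) w := by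
  rcases lt_or_ge w z with h | h
  · rw [if_pos h, steinSol_of_le h.le]
    have hd := (hasDerivAt_millsRatio w).const_mul (1 - Φ z)
    refine ((hd.congr_of_eventuallyEq ?_).congr_deriv (by ring)).hasDerivWithinAt
    filter_upwards [Iio_mem_nhds h] with x hx using steinSol_of_le (le_of_lt hx)
  · rw [if_neg h.not_gt, steinSol_of_ge h]
    have hd := ((hasDerivAt_millsRatio (-w)).comp w (hasDerivAt_neg w)).const_mul (Φ z)
    exact (hd.hasDerivWithinAt.congr (fun x hx => steinSol_of_ge (h.trans hx))
      (steinSol_of_ge h)).congr_deriv (by ring)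

/-- The function `w f w - 1_{w ≤ z}`, where `f = steinSol z`. It is monotone, and its increments
dominate those of `f'`. -/
noncomputable def steinMono (z w : ℝ) : ℝ := w * steinSol z w - if w ≤ z then 1 else 0

lemma abs_steinMono_sub_le_one (z w : ℝ) : |steinMono z w - (Φ z - 1)| ≤ 1 := by
  have h1 := cdf_sub_one_le_mul_steinSol z w
  have h2 := mul_steinSol_le_cdf z w
  rw [abs_le, steinMono]
  split_ifs <;> constructor <;> linarith

/-- The derivative of `steinSol z` prescribed by Stein's equation; at the kink `w = z` this is the
left derivative. -/
noncomputable def steinDeriv (z w : ℝ) : ℝ := w * steinSol z w + (if w ≤ z then 1 else 0) - Φ z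

lemma abs_steinDeriv_le_one (z w : ℝ) : |steinDeriv z w| ≤ 1 := by
  have h1 := cdf_sub_one_le_mul_steinSol z w
  have h2 := mul_steinSol_le_cdf z w
  rw [steinDeriv, abs_le]
  split_ifs <;> constructor <;> linarith

lemma abs_steinSol_sub_sub_le_of_forall_Ico {z l u c C : ℝ} (hlu : l ≤ u)
    (h : ∀ x ∈ Ico l u, |x * steinSol z x + (if x < z then 1 else 0) - Φ z - c| ≤ C) :
    |steinSol z u - steinSol z l - (u - l) * c| ≤ C * (u - l) := by
  have := norm_image_sub_le_of_norm_deriv_right_le_segment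
    ((continuous_steinSol z).sub (continuous_mul_const c)).continuousOn
    (fun x _ => (hasDerivWithinAt_steinSol z x).sub ((hasDerivWithinAt_id x _).mul_const c))
    (by simpa only [Real.norm_eq_abs, one_mul] using h) u (right_mem_Icc.2 hlu)
  rw [Real.norm_eq_abs] at this
  convert this using 2
  simp only [Pi.sub_apply]
  ring

lemma abs_steinSol_sub_sub_le (z a b : ℝ) :
    |steinSol z a - steinSol z b - (a - b) * steinDeriv z a| ≤
      (a - b) * (steinMono z a - steinMono z b) := by
  have hmono := monotone_mul_steinSol z
  rcases le_total a b with hab | hab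
  · calc _ = |steinSol z b - steinSol z a - (b - a) * steinDeriv z a| := by
          rw [← abs_neg]
          congr 1
          ring
      _ ≤ (steinMono z b - steinMono z a) * (b - a) := by
          refine abs_steinSol_sub_sub_le_of_forall_Ico hab fun x ⟨hax, hxb⟩ => ?_
          have h1 := hmono hax
          have h2 := hmono hxb.le
          simp only [steinDeriv, steinMono, abs_le] at h1 h2 ⊢
          split_ifs <;> constructor <;> linarith
      _ = _ := by ring
  · rw [mul_comm (a - b) (steinMono z a - _)]
    refine abs_steinSol_sub_sub_le_of_forall_Ico hab fun x ⟨hbx, hxa⟩ => ?_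
    have h1 := hmono hbx
    have h2 := hmono hxa.le
    simp only [steinDeriv, steinMono, abs_le] at h1 h2 ⊢
    split_ifs <;> constructor <;> linarith

lemma measurable_steinSol (z : ℝ) : Measurable (steinSol z) := (continuous_steinSol z).measurable

lemma measurable_mul_steinSol (z : ℝ) : Measurable fun w => w * steinSol z w :=
  measurable_id.mul (measurable_steinSol z)

lemma measurable_steinMono (z : ℝ) : Measurable (steinMono z) :=
  (measurable_mul_steinSol z).sub
    (measurable_const.ite measurableSet_Iic measurable_const)

lemma measurable_steinDeriv (z : ℝ) : Measurable (steinDeriv z) :=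
  ((measurable_mul_steinSol z).add
    (measurable_const.ite measurableSet_Iic measurable_const)).sub_const _

lemma integral_steinDeriv (ν : Measure ℝ) [IsProbabilityMeasure ν] (z : ℝ) :
    ∫ w, steinDeriv z w ∂ν = ∫ w, w * steinSol z w ∂ν + cdf ν z - Φ z := by
  have hmul : Integrable (fun w => w * steinSol z w) ν :=
    Integrable.of_bound (measurable_mul_steinSol z).aestronglyMeasurable 1
      (ae_of_all _ (abs_mul_steinSol_le_one z))
  have hite : (fun w => if w ≤ z then (1 : ℝ) else 0) = (Iic z).indicator 1 := by
    funext w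
    simp only [indicator_apply, mem_Iic, Pi.one_apply]
  have hind : Integrable (fun w => if w ≤ z then (1 : ℝ) else 0) ν := by
    rw [hite]
    exact (integrable_const 1).indicator measurableSet_Iic
  have hsum : Integrable (fun w => w * steinSol z w + if w ≤ z then 1 else 0) ν := hmul.add hind
  simp only [steinDeriv]
  rw [integral_sub hsum (integrable_const _), integral_add hmul hind, hite,
    integral_indicator_one measurableSet_Iic, ← cdf_eq_real ν, integral_const, probReal_univ,
    one_smul]

end SteinEquation

section Resampling

open scoped symmDiff

variable {ι A : Type*}

/-- Given a pair of points at every index, take the second point on `s` and the first elsewhere. -/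
def mix [DecidableEq ι] (s : Finset ι) (z : ι → A × A) : ι → A :=
  fun i => if i ∈ s then (z i).2 else (z i).1

/-- Given a pair of points at every index, exchange the two points of each pair on `s`. -/
def swapOn [DecidableEq ι] (s : Finset ι) (z : ι → A × A) : ι → A × A :=
  fun i => if i ∈ s then (z i).swap else z i

/-- The increment of `f` when the coordinate `j` is resampled. -/
def coordDiff [DecidableEq ι] (f : (ι → A) → ℝ) (j : ι) (z : ι → A × A) : ℝ :=
  f (mix ∅ z) - f (mix {j} z)

/-- The increment of `f` when the coordinate `j` is resampled after all those preceding it. -/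
def seqDiff [LinearOrder ι] [LocallyFiniteOrderBot ι] (f : (ι → A) → ℝ) (j : ι)
    (z : ι → A × A) : ℝ :=
  f (mix (Finset.Iio j) z) - f (mix (Finset.Iic j) z)

section DecidableEq

variable [DecidableEq ι]

lemma mix_swapOn (s t : Finset ι) (z : ι → A × A) : mix s (swapOn t z) = mix (s ∆ t) z := by
  funext i
  by_cases hs : i ∈ s <;> by_cases ht : i ∈ t <;> simp [mix, swapOn, Finset.mem_symmDiff, hs, ht]

lemma mix_empty (z : ι → A × A) : mix ∅ z = fun i => (z i).1 := by
  funext i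
  simp [mix]

lemma mix_univ [Fintype ι] (z : ι → A × A) : mix Finset.univ z = fun i => (z i).2 := by
  funext i
  simp [mix]

lemma mix_insert (s : Finset ι) (j : ι) (z : ι → A × A) :
    mix (insert j s) z = Function.update (mix s z) j (z j).2 := by
  funext i
  by_cases h : i = j
  · subst h
    simp [mix]
  · simp [mix, h]

lemma mix_singleton (j : ι) (z : ι → A × A) :
    mix {j} z = Function.update (mix ∅ z) j (z j).2 := mix_insert ∅ j z

lemma mix_update (s : Finset ι) (y : ι → A × A) (i : ι) (a : A × A) :
    mix s (Function.update y i a) = Function.update (mix s y) i (if i ∈ s then a.2 else a.1) := by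
  funext k
  by_cases hk : k = i
  · subst hk
    simp only [mix, Function.update_self]
  · simp only [mix, Function.update_of_ne hk]

lemma swapOn_update (s : Finset ι) (y : ι → A × A) (i : ι) (a : A × A) :
    swapOn s (Function.update y i a) =
      Function.update (swapOn s y) i (if i ∈ s then a.swap else a) := by
  funext k
  by_cases hk : k = i
  · subst hk
    simp only [swapOn, Function.update_self]
  · simp only [swapOn, Function.update_of_ne hk]

lemma coordDiff_swapOn_singleton (f : (ι → A) → ℝ) (j : ι) (z : ι → A × A) :
    coordDiff f j (swapOn {j} z) = -coordDiff f j z := by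
  simp only [coordDiff, mix_swapOn, ← Finset.bot_eq_empty, bot_symmDiff, symmDiff_self, neg_sub]

end DecidableEq

section LinearOrder

variable [LinearOrder ι]

section LocallyFiniteOrderBot

variable [LocallyFiniteOrderBot ι]

lemma Iio_symmDiff_singleton (j : ι) : Finset.Iio j ∆ {j} = Finset.Iic j := by
  rw [(Finset.disjoint_singleton_right.2 Finset.notMem_Iio_self).symmDiff_eq_sup,
    Finset.sup_eq_union, Finset.union_singleton, Finset.Iio_insert]

lemma seqDiff_eq_coordDiff_swapOn (f : (ι → A) → ℝ) (j : ι) (z : ι → A × A) :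
    seqDiff f j z = coordDiff f j (swapOn (Finset.Iio j) z) := by
  simp only [seqDiff, coordDiff, mix_swapOn, ← Finset.bot_eq_empty, bot_symmDiff,
    symmDiff_comm {j}, Iio_symmDiff_singleton]

lemma seqDiff_swapOn_singleton (f : (ι → A) → ℝ) (j : ι) (z : ι → A × A) :
    seqDiff f j (swapOn {j} z) = -seqDiff f j z := by
  simp only [seqDiff, mix_swapOn, ← Iio_symmDiff_singleton, symmDiff_symmDiff_cancel_right,
    neg_sub]

end LocallyFiniteOrderBot

lemma sum_filter_lt_sub_filter_le {M : Type*} [AddCommGroup M] (G : Finset ι → M) (s : Finset ι) :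
    ∑ j ∈ s, (G (s.filter (· < j)) - G (s.filter (· ≤ j))) = G ∅ - G s := by
  induction s using Finset.induction_on_max with
  | empty => simp
  | insert a s has ih =>
    have ha : a ∉ s := fun h => (has a h).false
    have hlt : (insert a s).filter (· < a) = s := by
      rw [Finset.filter_insert, if_neg (lt_irrefl a), Finset.filter_true_of_mem has]
    have hle : (insert a s).filter (· ≤ a) = insert a s :=
      Finset.filter_true_of_mem (by simpa using fun x hx => (has x hx).le)
    rw [Finset.sum_insert ha, hlt, hle, ← sub_add_sub_cancel (G ∅) (G s), ← ih, add_comm]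
    refine congrArg (· + _) (Finset.sum_congr rfl fun j hj => ?_)
    rw [Finset.filter_insert, if_neg (has j hj).not_gt, Finset.filter_insert,
      if_neg (has j hj).not_ge]

lemma sum_seqDiff [LocallyFiniteOrderBot ι] [Fintype ι] (f : (ι → A) → ℝ) (z : ι → A × A) :
    ∑ j, seqDiff f j z = f (mix ∅ z) - f (mix Finset.univ z) := by
  have hlt : ∀ j : ι, Finset.univ.filter (· < j) = Finset.Iio j := fun j => by ext; simp
  have hle : ∀ j : ι, Finset.univ.filter (· ≤ j) = Finset.Iic j := fun j => by ext; simp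
  rw [← sum_filter_lt_sub_filter_le (fun s => f (mix s z))]
  simp only [hlt, hle, seqDiff]

end LinearOrder

section Measurability

variable [MeasurableSpace A] {f : (ι → A) → ℝ}

lemma measurable_mix [DecidableEq ι] (s : Finset ι) : Measurable (mix (A := A) s) := by
  refine measurable_pi_lambda _ fun i => ?_
  unfold mix
  split_ifs
  exacts [(measurable_pi_apply i).snd, (measurable_pi_apply i).fst]

lemma measurable_coordDiff [DecidableEq ι] (hf : Measurable f) (j : ι) :
    Measurable (coordDiff f j) :=
  (hf.comp (measurable_mix ∅)).sub (hf.comp (measurable_mix {j}))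

lemma measurable_seqDiff [LinearOrder ι] [LocallyFiniteOrderBot ι] (hf : Measurable f) (j : ι) :
    Measurable (seqDiff f j) :=
  (hf.comp (measurable_mix _)).sub (hf.comp (measurable_mix _))

end Measurability

variable [Fintype ι] [MeasurableSpace A] (μ : ι → Measure A) [∀ i, IsProbabilityMeasure (μ i)]

/-- The law of an independent family whose `i`-th member is a pair of independent variables of
law `μ i`. -/
noncomputable abbrev pairLaw : Measure (ι → A × A) := Measure.pi fun i => (μ i).prod (μ i)

section DecidableEq

variable [DecidableEq ι]

lemma measurePreserving_mix (s : Finset ι) :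
    MeasurePreserving (mix s) (pairLaw μ) (Measure.pi μ) := by
  have := measurePreserving_pi (fun i => (μ i).prod (μ i)) μ
    (f := fun i => if i ∈ s then Prod.snd else Prod.fst) fun i => by
      split_ifs
      exacts [measurePreserving_snd, measurePreserving_fst]
  convert this using 3
  unfold mix
  split_ifs <;> rfl

lemma measurePreserving_swapOn (s : Finset ι) :
    MeasurePreserving (swapOn s) (pairLaw μ) (pairLaw μ) := by
  have := measurePreserving_pi (fun i => (μ i).prod (μ i)) (fun i => (μ i).prod (μ i))
    (f := fun i => if i ∈ s then Prod.swap else id) fun i => by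
      split_ifs
      exacts [Measure.measurePreserving_swap, MeasurePreserving.id _]
  convert this using 3
  unfold swapOn
  split_ifs <;> rfl

lemma indepFun_mix_univ_mix_empty :
    IndepFun (mix (A := A) (Finset.univ : Finset ι)) (mix ∅) (pairLaw μ) := by
  have h0 := measurePreserving_mix μ ∅
  have h1 := measurePreserving_mix μ Finset.univ
  refine IndepFun.symm ((indepFun_iff_map_prod_eq_prod_map_map h0.measurable.aemeasurable
    h1.measurable.aemeasurable).2 ?_)
  rw [h0.map_eq, h1.map_eq, ← (measurePreserving_arrowProdEquivProdArrow A A ι μ μ).map_eq]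
  simp only [mix_empty, mix_univ]
  rfl

variable {μ} {f g : (ι → A) → ℝ}

lemma memLp_coordDiff {p : ENNReal} (hf : MemLp f p (Measure.pi μ)) (j : ι) :
    MemLp (coordDiff f j) p (pairLaw μ) :=
  (hf.comp_measurePreserving (measurePreserving_mix μ ∅)).sub
    (hf.comp_measurePreserving (measurePreserving_mix μ {j}))

lemma integral_antisymm_mul_eq_half {D : (ι → A × A) → ℝ} {j : ι}
    (hD : ∀ z, D (swapOn {j} z) = -D z)
    (hDg : Integrable (fun z => D z * g (mix ∅ z)) (pairLaw μ)) :
    ∫ z, D z * g (mix ∅ z) ∂pairLaw μ = 1 / 2 * ∫ z, D z * coordDiff g j z ∂pairLaw μ := by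
  have hswap := measurePreserving_swapOn μ {j}
  have heq : (fun z => D z * g (mix ∅ z)) ∘ swapOn {j} = fun z => -(D z * g (mix {j} z)) := by
    funext z
    simp only [Function.comp_apply, hD, mix_swapOn, ← Finset.bot_eq_empty, bot_symmDiff,
      neg_mul]
  have hDg' : Integrable (fun z => D z * g (mix {j} z)) (pairLaw μ) := by
    have := hswap.integrable_comp_of_integrable hDg
    rw [heq] at this
    exact integrable_neg_iff.1 this
  have hneg : ∫ z, D z * g (mix {j} z) ∂pairLaw μ = -∫ z, D z * g (mix ∅ z) ∂pairLaw μ := by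
    rw [← hswap.hasLaw.integral_comp hDg.aestronglyMeasurable, heq, integral_neg, neg_neg]
  simp only [coordDiff, mul_sub]
  rw [integral_sub hDg hDg', hneg]
  ring

end DecidableEq

section LinearOrder

variable {μ} [LinearOrder ι] [LocallyFiniteOrderBot ι] {f g : (ι → A) → ℝ}

lemma memLp_seqDiff {p : ENNReal} (hf : MemLp f p (Measure.pi μ)) (j : ι) :
    MemLp (seqDiff f j) p (pairLaw μ) :=
  (hf.comp_measurePreserving (measurePreserving_mix μ (Finset.Iio j))).sub
    (hf.comp_measurePreserving (measurePreserving_mix μ (Finset.Iic j)))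

lemma integral_seqDiff_eq_zero (hf : Integrable f (Measure.pi μ)) (j : ι) :
    ∫ z, seqDiff f j z ∂pairLaw μ = 0 := by
  have hinteg := memLp_one_iff_integrable.1 (memLp_seqDiff (memLp_one_iff_integrable.2 hf) j)
  have := integral_antisymm_mul_eq_half (g := fun _ => 1) (seqDiff_swapOn_singleton f j)
    (by simpa only [mul_one] using hinteg)
  simpa [coordDiff] using this

theorem covariance_eq_half_sum_integral_diff (hf : MemLp f 2 (Measure.pi μ))
    (hg : MemLp g 2 (Measure.pi μ)) :
    cov[f, g; Measure.pi μ] =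
      1 / 2 * ∑ j, ∫ z, seqDiff f j z * coordDiff g j z ∂pairLaw μ := by
  have h0 := measurePreserving_mix μ (∅ : Finset ι)
  have h1 := measurePreserving_mix μ (Finset.univ : Finset ι)
  have hf0 := hf.comp_measurePreserving h0
  have hf1 := hf.comp_measurePreserving h1
  have hg0 := hg.comp_measurePreserving h0
  have hindep : cov[f ∘ mix Finset.univ, g ∘ mix ∅; pairLaw μ] = 0 :=
    ((indepFun_mix_univ_mix_empty μ).comp₀ h1.measurable.aemeasurable h0.measurable.aemeasurable
      (h1.map_eq ▸ hf.aemeasurable) (h0.map_eq ▸ hg.aemeasurable)).covariance_eq_zero hf1 hg0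
  have hterm : ∀ j, cov[seqDiff f j, g ∘ mix ∅; pairLaw μ] =
      1 / 2 * ∫ z, seqDiff f j z * coordDiff g j z ∂pairLaw μ := fun j => by
    have hs := memLp_seqDiff hf j
    rw [covariance_eq_sub hs hg0, integral_seqDiff_eq_zero (hf.integrable one_le_two), zero_mul,
      sub_zero]
    exact integral_antisymm_mul_eq_half (seqDiff_swapOn_singleton f j) (hs.integrable_mul hg0)
  calc cov[f, g; Measure.pi μ] = cov[f ∘ mix ∅, g ∘ mix ∅; pairLaw μ] := by
        rw [← h0.map_eq] at hf hg ⊢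
        exact covariance_map hf.1 hg.1 h0.measurable.aemeasurable
    _ = cov[fun z => ∑ j, seqDiff f j z, g ∘ mix ∅; pairLaw μ] := by
        rw [← sub_zero (cov[_, _; _]), ← hindep, ← covariance_sub_left hf0 hf1 hg0]
        simp only [sum_seqDiff]
        rfl
    _ = ∑ j, cov[seqDiff f j, g ∘ mix ∅; pairLaw μ] :=
        covariance_fun_sum_left' (fun j _ => memLp_seqDiff hf j) hg0
    _ = _ := by rw [Finset.mul_sum, Finset.sum_congr rfl fun j _ => hterm j]

/-- The Efron–Stein inequality. -/
theorem variance_le_half_sum_integral_coordDiff_sq (hf : MemLp f 2 (Measure.pi μ)) :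
    Var[f; Measure.pi μ] ≤ 1 / 2 * ∑ j, ∫ z, coordDiff f j z ^ 2 ∂pairLaw μ := by
  rw [← covariance_self hf.aemeasurable, covariance_eq_half_sum_integral_diff hf hf]
  refine mul_le_mul_of_nonneg_left (Finset.sum_le_sum fun j _ => ?_) (by norm_num)
  have hs := memLp_seqDiff hf j
  have hc := memLp_coordDiff hf j
  have hsc : ∫ z, seqDiff f j z ^ 2 ∂pairLaw μ = ∫ z, coordDiff f j z ^ 2 ∂pairLaw μ := by
    rw [← (measurePreserving_swapOn μ (Finset.Iio j)).hasLaw.integral_comp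
      hc.integrable_sq.aestronglyMeasurable]
    simp only [seqDiff_eq_coordDiff_swapOn, Function.comp_apply]
  calc ∫ z, seqDiff f j z * coordDiff f j z ∂pairLaw μ
      ≤ ∫ z, 1 / 2 * (seqDiff f j z ^ 2 + coordDiff f j z ^ 2) ∂pairLaw μ := by
        refine integral_mono (hs.integrable_mul hc)
          ((hs.integrable_sq.add hc.integrable_sq).const_mul _) fun z => ?_
        linarith [two_mul_le_add_sq (seqDiff f j z) (coordDiff f j z)]
    _ = ∫ z, coordDiff f j z ^ 2 ∂pairLaw μ := by
        rw [integral_const_mul, integral_add hs.integrable_sq hc.integrable_sq, hsc]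
        ring

end LinearOrder

end Resampling

section BoundedDifferences

variable {ι A : Type*}

/-- Changing the `i`-th coordinate changes `F` by at most `c i`. -/
def HasBoundedDifferences [DecidableEq ι] (F : (ι → A) → ℝ) (c : ι → ℝ) : Prop :=
  ∀ x i a, |F x - F (Function.update x i a)| ≤ c i

namespace HasBoundedDifferences

variable {F : (ι → A) → ℝ} {c : ι → ℝ}

lemma div_const [DecidableEq ι] (hF : HasBoundedDifferences F c) {d : ℝ} (hd : 0 ≤ d) :
    HasBoundedDifferences (fun x => F x / d) (fun i => c i / d) := fun x i a => by
  rw [← sub_div, abs_div, abs_of_nonneg hd]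
  exact div_le_div_of_nonneg_right (hF x i a) hd

lemma abs_coordDiff_le [DecidableEq ι] (hF : HasBoundedDifferences F c) (j : ι) (z : ι → A × A) :
    |coordDiff F j z| ≤ c j := by
  rw [coordDiff, mix_singleton]
  exact hF _ _ _

variable [LinearOrder ι] [LocallyFiniteOrderBot ι]

lemma abs_seqDiff_le (hF : HasBoundedDifferences F c) (j : ι) (z : ι → A × A) :
    |seqDiff F j z| ≤ c j := by
  rw [seqDiff_eq_coordDiff_swapOn]
  exact hF.abs_coordDiff_le _ _

variable [Fintype ι]

lemma abs_sub_le (hF : HasBoundedDifferences F c) (x y : ι → A) : |F x - F y| ≤ ∑ i, c i := by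
  have h := sum_seqDiff F fun i => (x i, y i)
  rw [mix_empty, mix_univ] at h
  rw [← h]
  exact (Finset.abs_sum_le_sum_abs _ _).trans
    (Finset.sum_le_sum fun j _ => hF.abs_seqDiff_le j _)

variable [MeasurableSpace A] {μ : ι → Measure A} [∀ i, IsProbabilityMeasure (μ i)]

lemma memLp (hF : HasBoundedDifferences F c) (hmeas : Measurable F) {p : ENNReal} :
    MemLp F p (Measure.pi μ) := by
  obtain ⟨x₀⟩ := nonempty_of_isProbabilityMeasure (Measure.pi μ)
  refine MemLp.of_bound hmeas.aestronglyMeasurable (|F x₀| + ∑ i, c i) (ae_of_all _ fun x => ?_)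
  calc |F x| = |F x₀ + (F x - F x₀)| := by rw [add_sub_cancel]
    _ ≤ |F x₀| + ∑ i, c i := (abs_add_le _ _).trans (by gcongr; exact hF.abs_sub_le x x₀)

lemma variance_le (hF : HasBoundedDifferences F c) (hmeas : Measurable F) :
    Var[F; Measure.pi μ] ≤ 1 / 2 * ∑ i, c i ^ 2 := by
  refine (variance_le_half_sum_integral_coordDiff_sq (hF.memLp hmeas)).trans ?_
  refine mul_le_mul_of_nonneg_left (Finset.sum_le_sum fun j _ => ?_) (by norm_num)
  calc ∫ z, coordDiff F j z ^ 2 ∂pairLaw μ ≤ ∫ _, c j ^ 2 ∂pairLaw μ :=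
        integral_mono (memLp_coordDiff (hF.memLp hmeas) j).integrable_sq (integrable_const _)
          fun z => sq_le_sq' (abs_le.1 (hF.abs_coordDiff_le j z)).1
            (abs_le.1 (hF.abs_coordDiff_le j z)).2
    _ = c j ^ 2 := by simp

end HasBoundedDifferences

lemma integral_abs_sub_integral_le_sqrt_variance {Ω : Type*} [MeasurableSpace Ω] {P : Measure Ω}
    [IsProbabilityMeasure P] {X : Ω → ℝ} (hX : MemLp X 2 P) :
    ∫ ω, |X ω - P[X]| ∂P ≤ √Var[X; P] := by
  have hdev : MemLp (fun ω => |X ω - P[X]|) 2 P := (hX.sub (memLp_const _)).abs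
  have h := variance_nonneg (fun ω => |X ω - P[X]|) P
  rw [variance_eq_sub hdev] at h
  refine Real.le_sqrt_of_sq_le ?_
  rw [variance_eq_integral hX.aemeasurable]
  simpa only [Pi.pow_apply, sq_abs, sub_nonneg] using h

end BoundedDifferences

section SteinBound

lemma abs_integral_mul_le_integral_abs {Ω : Type*} [MeasurableSpace Ω] {P : Measure Ω}
    {X g : Ω → ℝ} (hX : Integrable X P) (hg : ∀ ω, |g ω| ≤ 1) :
    |∫ ω, X ω * g ω ∂P| ≤ ∫ ω, |X ω| ∂P := by
  rw [← Real.norm_eq_abs]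
  refine norm_integral_le_of_norm_le hX.abs (ae_of_all _ fun ω => ?_)
  rw [norm_mul]
  exact mul_le_of_le_one_right (abs_nonneg _) (hg ω)

variable {ι A : Type*}

section Estimators

variable [LinearOrder ι] [LocallyFiniteOrderBot ι]

/-- The sum of products of increments whose mean is the variance of `W`, see
`integral_varEstimator`. -/
noncomputable def varEstimator [Fintype ι] (W : (ι → A) → ℝ) (y : ι → A × A) : ℝ :=
  1 / 2 * ∑ j, seqDiff W j y * coordDiff W j y

/-- The variant of `varEstimator` whose terms change sign when the `j`-th pair is exchanged. -/
def signedVarEstimator [Fintype ι] (W : (ι → A) → ℝ) (y : ι → A × A) : ℝ :=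
  ∑ j, |seqDiff W j y| * coordDiff W j y

lemma abs_seqDiff_mul_coordDiff_swapOn_singleton (W : (ι → A) → ℝ) (j : ι) (y : ι → A × A) :
    |seqDiff W j (swapOn {j} y)| * coordDiff W j (swapOn {j} y) =
      -(|seqDiff W j y| * coordDiff W j y) := by
  rw [seqDiff_swapOn_singleton, coordDiff_swapOn_singleton, abs_neg, mul_neg]

end Estimators

variable [Fintype ι] [MeasurableSpace A] {μ : ι → Measure A} [∀ i, IsProbabilityMeasure (μ i)]
  {W : (ι → A) → ℝ}

lemma memLp_steinSol_comp (hW : AEStronglyMeasurable W (Measure.pi μ)) (z : ℝ) {p : ENNReal} :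
    MemLp (steinSol z ∘ W) p (Measure.pi μ) := by
  obtain ⟨C, hC⟩ := exists_abs_steinSol_le z
  exact MemLp.of_bound ((continuous_steinSol z).comp_aestronglyMeasurable hW) C
    (ae_of_all _ fun x => hC (W x))

lemma memLp_steinMono_comp_sub (hW : AEMeasurable W (Measure.pi μ)) (z : ℝ) {p : ENNReal} :
    MemLp (fun x => steinMono z (W x) - (cdf (gaussianReal 0 1) z - 1)) p (Measure.pi μ) :=
  MemLp.of_bound (((measurable_steinMono z).comp_aemeasurable hW).sub_const _).aestronglyMeasurable
    1 (ae_of_all _ fun x => abs_steinMono_sub_le_one z (W x))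

lemma memLp_steinDeriv_comp (hW : AEMeasurable W (Measure.pi μ)) (z : ℝ) {p : ENNReal} :
    MemLp (steinDeriv z ∘ W) p (Measure.pi μ) :=
  MemLp.of_bound ((measurable_steinDeriv z).comp_aemeasurable hW).aestronglyMeasurable 1
    (ae_of_all _ fun x => abs_steinDeriv_le_one z (W x))

variable [LinearOrder ι] [LocallyFiniteOrderBot ι]

lemma integrable_seqDiff_mul_coordDiff (hW : MemLp W 2 (Measure.pi μ)) (j : ι) :
    Integrable (fun y => seqDiff W j y * coordDiff W j y) (pairLaw μ) :=
  (memLp_seqDiff hW j).integrable_mul (memLp_coordDiff hW j)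

lemma integrable_abs_seqDiff_mul_coordDiff (hW : MemLp W 2 (Measure.pi μ)) (j : ι) :
    Integrable (fun y => |seqDiff W j y| * coordDiff W j y) (pairLaw μ) :=
  (memLp_seqDiff hW j).abs.integrable_mul (memLp_coordDiff hW j)

lemma integrable_varEstimator (hW : MemLp W 2 (Measure.pi μ)) :
    Integrable (varEstimator W) (pairLaw μ) :=
  (integrable_finsetSum _ fun j _ => integrable_seqDiff_mul_coordDiff hW j).const_mul _

lemma integrable_signedVarEstimator (hW : MemLp W 2 (Measure.pi μ)) :
    Integrable (signedVarEstimator W) (pairLaw μ) :=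
  integrable_finsetSum _ fun j _ => integrable_abs_seqDiff_mul_coordDiff hW j

lemma integral_varEstimator (hW : MemLp W 2 (Measure.pi μ)) :
    ∫ y, varEstimator W y ∂pairLaw μ = Var[W; Measure.pi μ] := by
  rw [← covariance_self hW.aemeasurable, covariance_eq_half_sum_integral_diff hW hW,
    ← integral_finsetSum _ fun j _ => integrable_seqDiff_mul_coordDiff hW j, ← integral_const_mul]
  rfl

lemma integral_signedVarEstimator (hW : MemLp W 2 (Measure.pi μ)) :
    ∫ y, signedVarEstimator W y ∂pairLaw μ = 0 := by
  have hinteg := integrable_abs_seqDiff_mul_coordDiff hW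
  unfold signedVarEstimator
  rw [integral_finsetSum _ fun j _ => hinteg j]
  refine Finset.sum_eq_zero fun j _ => ?_
  have := integral_antisymm_mul_eq_half (g := fun _ => 1)
    (abs_seqDiff_mul_coordDiff_swapOn_singleton W j) (by simpa only [mul_one] using hinteg j)
  simpa [coordDiff] using this

lemma abs_integral_seqDiff_mul_taylor_le (hW : MemLp W 2 (Measure.pi μ)) (z : ℝ) (j : ι) :
    |∫ y, seqDiff W j y * (coordDiff (steinSol z ∘ W) j y
        - coordDiff W j y * steinDeriv z (W (mix ∅ y))) ∂pairLaw μ| ≤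
      2 * ∫ y, |seqDiff W j y| * coordDiff W j y
        * (steinMono z (W (mix ∅ y)) - (cdf (gaussianReal 0 1) z - 1)) ∂pairLaw μ := by
  set k : (ι → A) → ℝ := fun x => steinMono z (W x) - (cdf (gaussianReal 0 1) z - 1) with hk
  have hkLp : MemLp k ⊤ (Measure.pi μ) := memLp_steinMono_comp_sub hW.aemeasurable z
  have hprod := integrable_abs_seqDiff_mul_coordDiff hW j
  have htaylor : ∀ y, |seqDiff W j y * (coordDiff (steinSol z ∘ W) j y
      - coordDiff W j y * steinDeriv z (W (mix ∅ y)))| ≤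
      |seqDiff W j y| * coordDiff W j y * coordDiff k j y := fun y => by
    have h := abs_steinSol_sub_sub_le z (W (mix ∅ y)) (W (mix {j} y))
    rw [abs_mul, mul_assoc]
    refine mul_le_mul_of_nonneg_left ?_ (abs_nonneg _)
    simpa only [coordDiff, hk, Function.comp_apply, sub_sub_sub_cancel_right] using h
  have hswap := integral_antisymm_mul_eq_half (g := k)
    (abs_seqDiff_mul_coordDiff_swapOn_singleton W j)
    (hprod.mul_of_top_left (hkLp.comp_measurePreserving (measurePreserving_mix μ ∅)))
  have hinteg : Integrable (fun y => |seqDiff W j y| * coordDiff W j y * coordDiff k j y)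
      (pairLaw μ) := hprod.mul_of_top_left (memLp_coordDiff hkLp j)
  rw [← Real.norm_eq_abs]
  refine (norm_integral_le_of_norm_le hinteg (ae_of_all _ htaylor)).trans_eq ?_
  change _ = 2 * ∫ y, _ * k (mix ∅ y) ∂_
  rw [hswap]
  ring

lemma integral_varEstimator_mul (hW : MemLp W 2 (Measure.pi μ)) {g : (ι → A × A) → ℝ}
    (hg : MemLp g ⊤ (pairLaw μ)) :
    ∫ y, varEstimator W y * g y ∂pairLaw μ =
      1 / 2 * ∑ j, ∫ y, seqDiff W j y * coordDiff W j y * g y ∂pairLaw μ := by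
  have hinteg : ∀ j, Integrable (fun y => seqDiff W j y * coordDiff W j y * g y) (pairLaw μ) :=
    fun j => (integrable_seqDiff_mul_coordDiff hW j).mul_of_top_left hg
  rw [← integral_finsetSum _ fun j _ => hinteg j, ← integral_const_mul]
  simp only [varEstimator, Finset.sum_mul, mul_assoc]

lemma integral_signedVarEstimator_mul (hW : MemLp W 2 (Measure.pi μ)) {g : (ι → A × A) → ℝ}
    (hg : MemLp g ⊤ (pairLaw μ)) :
    ∫ y, signedVarEstimator W y * g y ∂pairLaw μ =
      ∑ j, ∫ y, |seqDiff W j y| * coordDiff W j y * g y ∂pairLaw μ := by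
  have hinteg : ∀ j, Integrable (fun y => |seqDiff W j y| * coordDiff W j y * g y) (pairLaw μ) :=
    fun j => (integrable_abs_seqDiff_mul_coordDiff hW j).mul_of_top_left hg
  rw [← integral_finsetSum _ fun j _ => hinteg j]
  simp only [signedVarEstimator, Finset.sum_mul]

lemma integral_mul_steinSol_eq (hW : MemLp W 2 (Measure.pi μ))
    (hmean : ∫ x, W x ∂Measure.pi μ = 0) (z : ℝ) :
    ∫ x, W x * steinSol z (W x) ∂Measure.pi μ =
      1 / 2 * ∑ j, ∫ y, seqDiff W j y * coordDiff (steinSol z ∘ W) j y ∂pairLaw μ := by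
  have hf : MemLp (steinSol z ∘ W) 2 (Measure.pi μ) :=
    memLp_steinSol_comp hW.aestronglyMeasurable z
  rw [← covariance_eq_half_sum_integral_diff hW hf, covariance_eq_sub hW hf, hmean, zero_mul,
    sub_zero]
  rfl

lemma abs_integral_mul_steinSol_sub_le (hW : MemLp W 2 (Measure.pi μ))
    (hmean : ∫ x, W x ∂Measure.pi μ = 0) (z : ℝ) :
    |∫ x, W x * steinSol z (W x) ∂Measure.pi μ
        - ∫ y, varEstimator W y * steinDeriv z (W (mix ∅ y)) ∂pairLaw μ| ≤
      ∫ y, |signedVarEstimator W y| ∂pairLaw μ := by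
  set D : (ι → A × A) → ℝ := fun y => steinDeriv z (W (mix ∅ y))
  set k : (ι → A × A) → ℝ := fun y =>
    steinMono z (W (mix ∅ y)) - (cdf (gaussianReal 0 1) z - 1)
  have hmix := measurePreserving_mix μ (∅ : Finset ι)
  have hD : MemLp D ⊤ (pairLaw μ) :=
    (memLp_steinDeriv_comp hW.aemeasurable z).comp_measurePreserving hmix
  have hk : MemLp k ⊤ (pairLaw μ) :=
    (memLp_steinMono_comp_sub hW.aemeasurable z).comp_measurePreserving hmix
  have hf : MemLp (steinSol z ∘ W) 2 (Measure.pi μ) :=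
    memLp_steinSol_comp hW.aestronglyMeasurable z
  rw [integral_mul_steinSol_eq hW hmean, integral_varEstimator_mul hW hD, ← mul_sub,
    ← Finset.sum_sub_distrib, abs_mul, abs_of_pos one_half_pos]
  calc 1 / 2 * |∑ j, (∫ y, seqDiff W j y * coordDiff (steinSol z ∘ W) j y ∂pairLaw μ
        - ∫ y, seqDiff W j y * coordDiff W j y * D y ∂pairLaw μ)|
      ≤ 1 / 2 * ∑ j, 2 * ∫ y, |seqDiff W j y| * coordDiff W j y * k y ∂pairLaw μ := by
        refine mul_le_mul_of_nonneg_left ((Finset.abs_sum_le_sum_abs _ _).trans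
          (Finset.sum_le_sum fun j _ => ?_)) one_half_pos.le
        have hfint : Integrable (fun y => seqDiff W j y * coordDiff (steinSol z ∘ W) j y)
            (pairLaw μ) := (memLp_seqDiff hW j).integrable_mul (memLp_coordDiff hf j)
        have hDint : Integrable (fun y => seqDiff W j y * coordDiff W j y * D y) (pairLaw μ) :=
          (integrable_seqDiff_mul_coordDiff hW j).mul_of_top_left hD
        rw [← integral_sub hfint hDint]
        simp only [mul_assoc (seqDiff W j _), ← mul_sub]
        exact abs_integral_seqDiff_mul_taylor_le hW z j
    _ = ∫ y, signedVarEstimator W y * k y ∂pairLaw μ := by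
        rw [← Finset.mul_sum, ← mul_assoc, one_div_mul_cancel two_ne_zero, one_mul,
          integral_signedVarEstimator_mul hW hk]
    _ ≤ ∫ y, |signedVarEstimator W y| ∂pairLaw μ :=
        (le_abs_self _).trans (abs_integral_mul_le_integral_abs
          (integrable_signedVarEstimator hW) fun y => abs_steinMono_sub_le_one z _)

theorem kolmogorovDist_map_gaussianReal_le (hW : MemLp W 2 (Measure.pi μ))
    (hmean : ∫ x, W x ∂Measure.pi μ = 0) :
    kolmogorovDist ((Measure.pi μ).map W) (gaussianReal 0 1) ≤
      ∫ y, |varEstimator W y - 1| ∂pairLaw μ + ∫ y, |signedVarEstimator W y| ∂pairLaw μ := by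
  refine ciSup_le fun z => ?_
  have := Measure.isProbabilityMeasure_map hW.aemeasurable
  have hmix := measurePreserving_mix μ (∅ : Finset ι)
  have hD : MemLp (steinDeriv z ∘ W) 1 (Measure.pi μ) := memLp_steinDeriv_comp hW.aemeasurable z
  have hD' : MemLp (fun y => steinDeriv z (W (mix ∅ y))) ⊤ (pairLaw μ) :=
    (memLp_steinDeriv_comp hW.aemeasurable z).comp_measurePreserving hmix
  have hvar := integrable_varEstimator hW
  have hvarD : Integrable (fun y => varEstimator W y * steinDeriv z (W (mix ∅ y))) (pairLaw μ) :=
    hvar.mul_of_top_left hD'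
  have hstein := integral_steinDeriv ((Measure.pi μ).map W) z
  rw [integral_map hW.aemeasurable (measurable_steinDeriv z).aestronglyMeasurable,
    integral_map hW.aemeasurable
      (measurable_mul_steinSol z).aestronglyMeasurable] at hstein
  have hDmix : ∫ y, steinDeriv z (W (mix ∅ y)) ∂pairLaw μ =
      ∫ x, steinDeriv z (W x) ∂Measure.pi μ :=
    hmix.hasLaw.integral_comp hD.aestronglyMeasurable
  have hdist : cdf ((Measure.pi μ).map W) z - cdf (gaussianReal 0 1) z =
      -(∫ y, (varEstimator W y - 1) * steinDeriv z (W (mix ∅ y)) ∂pairLaw μ)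
        - (∫ x, W x * steinSol z (W x) ∂Measure.pi μ
          - ∫ y, varEstimator W y * steinDeriv z (W (mix ∅ y)) ∂pairLaw μ) := by
    simp only [sub_mul, one_mul]
    rw [integral_sub hvarD (hD'.integrable le_top), hDmix]
    linarith
  rw [← cdf_eq_real, ← cdf_eq_real, hdist]
  refine (abs_sub _ _).trans (add_le_add ?_ (abs_integral_mul_steinSol_sub_le hW hmean z))
  rw [abs_neg]
  exact abs_integral_mul_le_integral_abs (hvar.sub (integrable_const 1))
    fun y => abs_steinDeriv_le_one z _

end SteinBound

section SecondDifferences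

variable {ι A : Type*}

section DecidableEq

variable [DecidableEq ι]

namespace HasBoundedDifferences

variable {F G : (ι → A) → ℝ} {b c : ι → ℝ} {B : ℝ}

lemma abs (hF : HasBoundedDifferences F c) : HasBoundedDifferences (fun x => |F x|) c :=
  fun x i a => (abs_abs_sub_abs_le _ _).trans (hF x i a)

lemma sub_const (hF : HasBoundedDifferences F c) (d : ℝ) :
    HasBoundedDifferences (fun x => F x - d) c := fun x i a => by
  rw [sub_sub_sub_cancel_right]
  exact hF x i a

lemma const_mul (hF : HasBoundedDifferences F c) {d : ℝ} (hd : 0 ≤ d) :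
    HasBoundedDifferences (fun x => d * F x) (fun i => d * c i) := fun x i a => by
  rw [← mul_sub, abs_mul, abs_of_nonneg hd]
  exact mul_le_mul_of_nonneg_left (hF x i a) hd

lemma sum {κ : Type*} {s : Finset κ} {F : κ → (ι → A) → ℝ} {c : κ → ι → ℝ}
    (hF : ∀ k ∈ s, HasBoundedDifferences (F k) (c k)) :
    HasBoundedDifferences (fun x => ∑ k ∈ s, F k x) (fun i => ∑ k ∈ s, c k i) := fun x i a => by
  rw [← Finset.sum_sub_distrib]
  exact (Finset.abs_sum_le_sum_abs _ _).trans (Finset.sum_le_sum fun k hk => hF k hk x i a)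

lemma mul (hF : HasBoundedDifferences F b) (hG : HasBoundedDifferences G c)
    (hFB : ∀ x, |F x| ≤ B) (hGB : ∀ x, |G x| ≤ B) :
    HasBoundedDifferences (fun x => F x * G x) (fun i => B * (b i + c i)) := fun x i a => by
  set x' := Function.update x i a
  have hB : 0 ≤ B := (abs_nonneg _).trans (hFB x)
  calc |F x * G x - F x' * G x'| = |G x * (F x - F x') + F x' * (G x - G x')| := by ring_nf
    _ ≤ |G x| * |F x - F x'| + |F x'| * |G x - G x'| := by
        simpa only [abs_mul] using abs_add_le (G x * (F x - F x')) (F x' * (G x - G x'))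
    _ ≤ B * b i + B * c i := by
        gcongr
        exacts [hGB x, hF x i a, hFB x', hG x i a]
    _ = B * (b i + c i) := (mul_add _ _ _).symm

end HasBoundedDifferences

/-- Second-order analogue of `HasBoundedDifferences`: changing the `i`-th coordinate changes the
increment of `F` along the `j`-th one by at most `R j i`. For `i = j`, where the endpoint of the
increment may change as well, this reduces to first-order differences. -/
structure HasBoundedSecondDifferences (F : (ι → A) → ℝ) (b : ι → ℝ) (R : ι → ι → ℝ) : Prop where
  first : HasBoundedDifferences F b
  second : ∀ j c, HasBoundedDifferences (fun x => F x - F (Function.update x j c)) (R j)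
  two_mul_le : ∀ j, 2 * b j ≤ R j j

namespace HasBoundedSecondDifferences

variable {F : (ι → A) → ℝ} {b : ι → ℝ} {R : ι → ι → ℝ}

lemma coordDiff (hF : HasBoundedSecondDifferences F b R) (j : ι) :
    HasBoundedDifferences (coordDiff F j) (R j) := fun y i a => by
  by_cases hij : i = j
  · subst hij
    have h := abs_sub (_root_.coordDiff F i y) (_root_.coordDiff F i (Function.update y i a))
    linarith [hF.first.abs_coordDiff_le i y, hF.first.abs_coordDiff_le i (Function.update y i a),
      hF.two_mul_le i]
  · simpa only [_root_.coordDiff, mix_update, mix_singleton, Finset.notMem_empty,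
      Finset.mem_singleton, hij, if_false, Function.update_comm (Ne.symm hij)] using
      hF.second j (y j).2 (mix ∅ y) i a.1

lemma seqDiff {ι : Type*} [LinearOrder ι] [LocallyFiniteOrderBot ι] {F : (ι → A) → ℝ}
    {b : ι → ℝ} {R : ι → ι → ℝ} (hF : HasBoundedSecondDifferences F b R) (j : ι) :
    HasBoundedDifferences (seqDiff F j) (R j) := fun y i a => by
  simp only [seqDiff_eq_coordDiff_swapOn, swapOn_update]
  exact hF.coordDiff j _ i _

lemma sub_const_div_const (hF : HasBoundedSecondDifferences F b R) (m : ℝ) {d : ℝ} (hd : 0 ≤ d) :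
    HasBoundedSecondDifferences (fun x => (F x - m) / d) (fun i => b i / d)
      (fun j i => R j i / d) where
  first := (hF.first.sub_const m).div_const hd
  second j c := by
    simpa only [← sub_div, sub_sub_sub_cancel_right] using (hF.second j c).div_const hd
  two_mul_le j := by
    rw [← mul_div_assoc]
    exact div_le_div_of_nonneg_right (hF.two_mul_le j) hd

end HasBoundedSecondDifferences

end DecidableEq

section NormalApproximation

variable [LinearOrder ι] [LocallyFiniteOrderBot ι] [Fintype ι] {F W : (ι → A) → ℝ} {b : ι → ℝ}
  {R : ι → ι → ℝ}

lemma HasBoundedSecondDifferences.varEstimator (hW : HasBoundedSecondDifferences W b R) :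
    HasBoundedDifferences (varEstimator W) (fun i => ∑ j, b j * R j i) := by
  have h := (HasBoundedDifferences.sum (s := Finset.univ) fun j _ =>
    (hW.seqDiff j).mul (hW.coordDiff j) (hW.first.abs_seqDiff_le j)
      (hW.first.abs_coordDiff_le j)).const_mul one_half_pos.le
  refine fun y i a => (h y i a).trans_eq ?_
  simp only [Finset.mul_sum]
  exact Finset.sum_congr rfl fun j _ => by ring

lemma HasBoundedSecondDifferences.signedVarEstimator (hW : HasBoundedSecondDifferences W b R) :
    HasBoundedDifferences (signedVarEstimator W) (fun i => 2 * ∑ j, b j * R j i) := by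
  have h := HasBoundedDifferences.sum (s := Finset.univ) fun j _ =>
    (hW.seqDiff j).abs.mul (hW.coordDiff j)
      (fun y => (abs_abs _).trans_le (hW.first.abs_seqDiff_le j y)) (hW.first.abs_coordDiff_le j)
  refine fun y i a => (h y i a).trans_eq ?_
  simp only [Finset.mul_sum]
  exact Finset.sum_congr rfl fun j _ => by ring

variable [MeasurableSpace A] {μ : ι → Measure A} [∀ i, IsProbabilityMeasure (μ i)]

lemma measurable_varEstimator (hW : Measurable W) : Measurable (varEstimator W) :=
  (Finset.measurable_fun_sum _ fun j _ =>
    (measurable_seqDiff hW j).mul (measurable_coordDiff hW j)).const_mul _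

lemma measurable_signedVarEstimator (hW : Measurable W) : Measurable (signedVarEstimator W) :=
  Finset.measurable_fun_sum _ fun j _ =>
    (measurable_seqDiff hW j).abs.mul (measurable_coordDiff hW j)

lemma HasBoundedDifferences.integral_abs_sub_integral_le (hF : HasBoundedDifferences F b)
    (hmeas : Measurable F) :
    ∫ x, |F x - (Measure.pi μ)[F]| ∂Measure.pi μ ≤ √(1 / 2 * ∑ i, b i ^ 2) :=
  (integral_abs_sub_integral_le_sqrt_variance (hF.memLp hmeas)).trans
    (Real.sqrt_le_sqrt (hF.variance_le hmeas))

lemma HasBoundedSecondDifferences.kolmogorovDist_le_of_variance_eq_one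
    (hW : HasBoundedSecondDifferences W b R) (hmeas : Measurable W)
    (hmean : (Measure.pi μ)[W] = 0) (hvar : Var[W; Measure.pi μ] = 1) :
    kolmogorovDist ((Measure.pi μ).map W) (gaussianReal 0 1) ≤
      3 * √(1 / 2 * ∑ i, (∑ j, b j * R j i) ^ 2) := by
  have hLp : MemLp W 2 (Measure.pi μ) := hW.first.memLp hmeas
  have hT := hW.varEstimator.integral_abs_sub_integral_le (measurable_varEstimator hmeas)
    (μ := fun i => (μ i).prod (μ i))
  have hS := hW.signedVarEstimator.integral_abs_sub_integral_le
    (measurable_signedVarEstimator hmeas) (μ := fun i => (μ i).prod (μ i))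
  rw [integral_varEstimator hLp, hvar] at hT
  rw [integral_signedVarEstimator hLp] at hS
  simp only [mul_pow, ← Finset.mul_sum, mul_left_comm (1 / 2 : ℝ), sub_zero] at hS
  rw [Real.sqrt_mul (by norm_num), Real.sqrt_sq zero_le_two] at hS
  linarith [kolmogorovDist_map_gaussianReal_le hLp hmean]

theorem HasBoundedSecondDifferences.kolmogorovDist_le (hF : HasBoundedSecondDifferences F b R)
    (hmeas : Measurable F) (hvar : 0 < Var[F; Measure.pi μ]) :
    kolmogorovDist ((Measure.pi μ).map
        fun x => (F x - (Measure.pi μ)[F]) / √Var[F; Measure.pi μ]) (gaussianReal 0 1) ≤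
      3 * √(1 / 2 * ∑ i, (∑ j, b j * R j i) ^ 2) / Var[F; Measure.pi μ] := by
  set m := (Measure.pi μ)[F]
  set V := Var[F; Measure.pi μ] with hV
  have hLp : MemLp F 2 (Measure.pi μ) := hF.first.memLp hmeas
  have hinteg : Integrable F (Measure.pi μ) := hLp.integrable one_le_two
  have hmean : ∫ x, (F x - m) / √V ∂Measure.pi μ = 0 := by
    rw [integral_div, integral_sub hinteg (integrable_const m), integral_const, probReal_univ,
      one_smul, sub_self, zero_div]
  have hone : Var[fun x => (F x - m) / √V; Measure.pi μ] = 1 := by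
    simp only [div_eq_inv_mul]
    rw [variance_const_mul, variance_sub_const hmeas.aestronglyMeasurable, ← hV, inv_pow,
      Real.sq_sqrt hvar.le, inv_mul_cancel₀ hvar.ne']
  have hsum : ∑ i, (∑ j, b j / √V * (R j i / √V)) ^ 2 = (∑ i, (∑ j, b j * R j i) ^ 2) / V ^ 2 := by
    simp only [div_mul_div_comm, Real.mul_self_sqrt hvar.le, ← Finset.sum_div, div_pow]
  refine ((hF.sub_const_div_const m V.sqrt_nonneg).kolmogorovDist_le_of_variance_eq_one
    ((hmeas.sub_const m).div_const _) hmean hone).trans_eq ?_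
  rw [hsum, ← mul_div_assoc, Real.sqrt_div (by positivity), Real.sqrt_sq hvar.le, mul_div_assoc]

end NormalApproximation

end SecondDifferences

section LocalDependence

open scoped Finset

variable {ι A κ : Type*} {h : κ → (ι → A) → ℝ} {N : κ → Finset ι} {S : Finset κ}
  {Q : ℕ}

section DecidableEq

variable [DecidableEq ι]

lemma apply_update_of_dependsOn {β : Type*} {f : (ι → A) → β} {s : Finset ι} (hf : DependsOn f s)
    {i : ι} (hi : i ∉ s) (x : ι → A) (a : A) : f (Function.update x i a) = f x :=
  hf fun _ hk => Function.update_of_ne (ne_of_mem_of_not_mem hk hi) a x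

lemma hasBoundedDifferences_of_dependsOn {f : (ι → A) → ℝ} {s : Finset ι} (hf : DependsOn f s)
    {a d : ℝ} (hfa : ∀ x, f x ∈ Set.Icc a (a + d)) :
    HasBoundedDifferences f (fun i => if i ∈ s then d else 0) := fun x i c => by
  have h1 := hfa x
  have h2 := hfa (Function.update x i c)
  dsimp only
  split_ifs with hi
  · rw [abs_le]
    constructor <;> linarith [h1.1, h1.2, h2.1, h2.2]
  · rw [apply_update_of_dependsOn hf hi, sub_self, abs_zero]

lemma dependsOn_sub_update {f : (ι → A) → ℝ} {s : Finset ι} (hf : DependsOn f s) (j : ι) (c : A) :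
    DependsOn (fun x => f x - f (Function.update x j c)) s := fun _ _ hxy =>
  congrArg₂ _ (hf hxy) ((hf.update j c).mono (s.erase_subset j) hxy)

lemma hasBoundedSecondDifferences_sum (h01 : ∀ I ∈ S, ∀ x, h I x ∈ Set.Icc 0 1)
    (hdep : ∀ I ∈ S, DependsOn (h I) (N I)) :
    HasBoundedSecondDifferences (fun x => ∑ I ∈ S, h I x) (fun j => #{I ∈ S | j ∈ N I})
      (fun j i => 2 * #{I ∈ S | j ∈ N I ∧ i ∈ N I}) where
  first := by
    simpa only [Finset.sum_boole] using HasBoundedDifferences.sum fun I hI =>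
      hasBoundedDifferences_of_dependsOn (hdep I hI) (a := 0) (d := 1)
        (by simpa only [zero_add] using h01 I hI)
  second j c := by
    have hterm : ∀ I ∈ S, HasBoundedDifferences (fun x => h I x - h I (Function.update x j c))
        (fun i => 2 * if j ∈ N I ∧ i ∈ N I then 1 else 0) := fun I hI => by
      by_cases hj : j ∈ N I
      · simpa only [hj, true_and, mul_ite, mul_one, mul_zero] using
          hasBoundedDifferences_of_dependsOn (dependsOn_sub_update (hdep I hI) j c)
            (a := -1) (d := 2) fun x => by
              have h1 := h01 I hI x
              have h2 := h01 I hI (Function.update x j c)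
              constructor <;> linarith [h1.1, h1.2, h2.1, h2.2]
      · intro x i a
        simp [hj, apply_update_of_dependsOn (hdep I hI) hj]
    simpa only [← Finset.mul_sum, Finset.sum_boole, ← Finset.sum_sub_distrib] using
      HasBoundedDifferences.sum hterm
  two_mul_le j := by simp

lemma sum_card_filter_mem_and_mem_le [Fintype ι] {s : ℕ} (hs : ∀ I ∈ S, #(N I) ≤ s)
    (hQ : ∀ j, #{I ∈ S | j ∈ N I} ≤ Q) (i : ι) :
    ∑ j, #{I ∈ S | j ∈ N I ∧ i ∈ N I} ≤ s * Q :=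
  calc ∑ j, #{I ∈ S | j ∈ N I ∧ i ∈ N I} = ∑ I ∈ S with i ∈ N I, #(N I) := by
        simp only [← Finset.filter_filter, and_comm (b := i ∈ N _)]
        exact (Finset.sum_card_bipartiteAbove_eq_sum_card_bipartiteBelow fun j I => j ∈ N I).trans
          (by simp [Finset.bipartiteBelow])
    _ ≤ #{I ∈ S | i ∈ N I} * s :=
        Finset.sum_le_card_nsmul _ _ _ fun I hI => hs I (Finset.mem_filter.1 hI).1
    _ ≤ s * Q := by rw [mul_comm]; exact Nat.mul_le_mul_left s (hQ i)

end DecidableEq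

lemma sqrt_half_sum_sq_le [Fintype ι] {a : ι → ℝ} {c : ℝ} (ha0 : ∀ i, 0 ≤ a i)
    (hac : ∀ i, a i ≤ c) : √(1 / 2 * ∑ i, a i ^ 2) ≤ c * √(Fintype.card ι / 2) := by
  rcases isEmpty_or_nonempty ι with hι | ⟨⟨i₀⟩⟩
  · simp
  calc √(1 / 2 * ∑ i, a i ^ 2) ≤ √(1 / 2 * ∑ _i : ι, c ^ 2) := by
        gcongr with i
        exacts [ha0 i, hac i]
    _ = √(c ^ 2 * (Fintype.card ι / 2)) := by
        rw [Finset.sum_const, Finset.card_univ, nsmul_eq_mul]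
        ring_nf
    _ = c * √(Fintype.card ι / 2) := by
        rw [Real.sqrt_mul (sq_nonneg c), Real.sqrt_sq ((ha0 i₀).trans (hac i₀))]

theorem kolmogorovDist_sum_gaussianReal_le_of_dependsOn [Fintype ι] [LinearOrder ι]
    [LocallyFiniteOrderBot ι] [MeasurableSpace A] {μ : ι → Measure A}
    [∀ i, IsProbabilityMeasure (μ i)] {s : ℕ} (hmeas : ∀ I ∈ S, Measurable (h I))
    (h01 : ∀ I ∈ S, ∀ x, h I x ∈ Set.Icc 0 1) (hdep : ∀ I ∈ S, DependsOn (h I) (N I))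
    (hs : ∀ I ∈ S, #(N I) ≤ s) (hQ : ∀ j, #{I ∈ S | j ∈ N I} ≤ Q) {F : (ι → A) → ℝ}
    (hF : ∀ x, F x = ∑ I ∈ S, h I x) (hvar : 0 < Var[F; Measure.pi μ]) :
    kolmogorovDist ((Measure.pi μ).map
        fun x => (F x - (Measure.pi μ)[F]) / √Var[F; Measure.pi μ]) (gaussianReal 0 1) ≤
      6 * s * Q ^ 2 * √(Fintype.card ι / 2) / Var[F; Measure.pi μ] := by
  have hsum : ∀ i, ∑ j, (#{I ∈ S | j ∈ N I} : ℝ) * (2 * #{I ∈ S | j ∈ N I ∧ i ∈ N I}) ≤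
      2 * s * Q ^ 2 := fun i =>
    calc _ ≤ ∑ j, (Q : ℝ) * (2 * #{I ∈ S | j ∈ N I ∧ i ∈ N I}) := by
          exact Finset.sum_le_sum fun j _ => mul_le_mul_of_nonneg_right (Nat.cast_le.2 (hQ j))
            (mul_nonneg zero_le_two (Nat.cast_nonneg _))
      _ = 2 * Q * (∑ j, #{I ∈ S | j ∈ N I ∧ i ∈ N I} : ℕ) := by
          rw [Nat.cast_sum, Finset.mul_sum]
          exact Finset.sum_congr rfl fun j _ => by ring
      _ ≤ 2 * Q * (s * Q : ℕ) := by
          gcongr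
          exact sum_card_filter_mem_and_mem_le hs hQ i
      _ = 2 * s * Q ^ 2 := by
          push_cast
          ring
  obtain rfl : F = fun x => ∑ I ∈ S, h I x := funext hF
  refine ((hasBoundedSecondDifferences_sum h01 hdep).kolmogorovDist_le
    (Finset.measurable_fun_sum _ hmeas) hvar).trans (div_le_div_of_nonneg_right ?_ hvar.le)
  rw [show (6 * s * Q ^ 2 * √(Fintype.card ι / 2) : ℝ) =
    3 * (2 * s * Q ^ 2 * √(Fintype.card ι / 2)) by ring]
  refine mul_le_mul_of_nonneg_left (sqrt_half_sum_sq_le (fun i => ?_) hsum) zero_le_three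
  exact Finset.sum_nonneg fun j _ =>
    mul_nonneg (Nat.cast_nonneg _) (mul_nonneg zero_le_two (Nat.cast_nonneg _))

end LocalDependence

section ConvergenceInDistribution

open Set
open scoped Topology

lemma kolmogorovDist_nonneg (μ ν : Measure ℝ) : 0 ≤ kolmogorovDist μ ν :=
  Real.iSup_nonneg fun _ => abs_nonneg _

lemma abs_sub_le_kolmogorovDist (μ ν : Measure ℝ) [IsProbabilityMeasure μ]
    [IsProbabilityMeasure ν] (x : ℝ) :
    |μ.real (Iic x) - ν.real (Iic x)| ≤ kolmogorovDist μ ν := by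
  refine le_ciSup (f := fun x => |μ.real (Iic x) - ν.real (Iic x)|) ⟨1, ?_⟩ x
  rintro _ ⟨y, rfl⟩
  exact abs_sub_le_of_nonneg_of_le measureReal_nonneg measureReal_le_one measureReal_nonneg
    measureReal_le_one

variable {ι : Type*} {l : Filter ι} [l.IsCountablyGenerated]

lemma tendsto_of_forall_tendsto_measureReal_Iic
    {μ : ι → ProbabilityMeasure ℝ} {ν : ProbabilityMeasure ℝ}
    (h : ∀ y, Tendsto (fun i => (μ i : Measure ℝ).real (Iic y)) l
      (𝓝 ((ν : Measure ℝ).real (Iic y)))) : Tendsto μ l (𝓝 ν) := by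
  refine IsPiSystem.tendsto_probabilityMeasure_of_tendsto_of_mem
    (S := {s | ∃ a b : ℝ, a < b ∧ Ioc a b = s}) (by simpa using isPiSystem_Ioc (id : ℝ → ℝ) id)
    ?_ (fun u hu x hx => ?_) ?_
  · rintro _ ⟨a, b, -, rfl⟩
    exact measurableSet_Ioc
  · obtain ⟨ε, hε, hb⟩ := Metric.isOpen_iff.1 hu x hx
    refine ⟨Ioc (x - ε / 2) (x + ε / 2), ⟨_, _, by linarith, rfl⟩,
      Ioc_mem_nhds (by linarith) (by linarith), fun y hy => hb ?_⟩
    rw [Metric.mem_ball, Real.dist_eq, abs_lt]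
    constructor <;> linarith [hy.1, hy.2]
  · rintro _ ⟨a, b, hab, rfl⟩
    have key : ∀ m : ProbabilityMeasure ℝ, ((m (Ioc a b) : NNReal) : ℝ) =
        (m : Measure ℝ).real (Iic b) - (m : Measure ℝ).real (Iic a) := fun m => by
      rw [← Iic_sdiff_Iic, ← measureReal_sdiff (Iic_subset_Iic.2 hab.le) measurableSet_Iic]
      rfl
    rw [← NNReal.tendsto_coe]
    simp only [key]
    exact (h b).sub (h a)

lemma continuous_gaussianReal_real_Iic : Continuous fun z => (gaussianReal 0 1).real (Iic z) := by
  simp only [← cdf_eq_real]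
  exact continuous_iff_continuousAt.2 fun w => (hasDerivAt_gaussianReal_cdf w).continuousAt

lemma gaussianReal_sq_real_Iic {σ : ℝ} (hσ : 0 < σ) (y : ℝ) :
    (gaussianReal 0 (σ ^ 2).toNNReal).real (Iic y) = (gaussianReal 0 1).real (Iic (y / σ)) := by
  have h := gaussianReal_map_const_mul (μ := 0) (v := 1) σ
  rw [mul_zero, mul_one] at h
  rw [Real.toNNReal_of_nonneg (sq_nonneg σ)]
  refine (congrArg (fun μ => Measure.real μ (Iic y)) h).symm.trans ?_
  rw [map_measureReal_apply (measurable_const_mul σ) measurableSet_Iic]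
  congr 1
  ext x
  simp only [mem_preimage, mem_Iic, le_div_iff₀' hσ]

variable {Ω : ι → Type*} [∀ i, MeasurableSpace (Ω i)] {P : ∀ i, Measure (Ω i)}
  [∀ i, IsProbabilityMeasure (P i)] {Y : ∀ i, Ω i → ℝ}

theorem tendstoInDistribution_div_of_tendsto_kolmogorovDist
    {s a : ι → ℝ} {σ : ℝ} (hY : ∀ i, AEMeasurable (Y i) (P i)) (ha : ∀ᶠ i in l, 0 < a i)
    (hσ : 0 < σ) (hsa : Tendsto (fun i => s i / a i) l (𝓝 σ))
    (hd : Tendsto (fun i => kolmogorovDist ((P i).map fun ω => Y i ω / s i) (gaussianReal 0 1))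
      l (𝓝 0)) :
    TendstoInDistribution (fun i ω => Y i ω / a i) l (fun y : ℝ => y) P
      (gaussianReal 0 (σ ^ 2).toNNReal) where
  forall_aemeasurable i := (hY i).div_const _
  tendsto := by
    refine tendsto_of_forall_tendsto_measureReal_Iic fun y => ?_
    simp only [ProbabilityMeasure.coe_mk, Measure.map_id', gaussianReal_sq_real_Iic hσ]
    have hlim : Tendsto (fun i => (gaussianReal 0 1).real (Iic (y / (s i / a i)))) l
        (𝓝 ((gaussianReal 0 1).real (Iic (y / σ)))) :=
      (continuous_gaussianReal_real_Iic.tendsto _).comp (tendsto_const_nhds.div hsa hσ.ne')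
    have hdiff : Tendsto (fun i => ((P i).map fun ω => Y i ω / a i).real (Iic y)
        - (gaussianReal 0 1).real (Iic (y / (s i / a i)))) l (𝓝 0) := by
      refine squeeze_zero_norm' ?_ hd
      filter_upwards [ha, hsa.eventually (lt_mem_nhds hσ)] with i hai hsi
      have hs : 0 < s i := (div_pos_iff_of_pos_right hai).1 hsi
      have : IsProbabilityMeasure ((P i).map fun ω => Y i ω / s i) :=
        Measure.isProbabilityMeasure_map ((hY i).div_const _)
      have hset : (fun ω => Y i ω / a i) ⁻¹' Iic y =
          (fun ω => Y i ω / s i) ⁻¹' Iic (y / (s i / a i)) := by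
        ext ω
        simp only [mem_preimage, mem_Iic]
        rw [div_le_iff₀ hai, div_le_iff₀ hs, div_div_eq_mul_div, div_mul_cancel₀ _ hs.ne']
      rw [Real.norm_eq_abs, map_measureReal_apply_of_aemeasurable ((hY i).div_const _)
        measurableSet_Iic, hset, ← map_measureReal_apply_of_aemeasurable ((hY i).div_const _)
        measurableSet_Iic]
      exact abs_sub_le_kolmogorovDist _ _ _
    simpa only [sub_add_cancel, zero_add] using hdiff.add hlim

theorem tendstoInDistribution_dirac_of_tendsto_integral_abs_sub {c : ℝ}
    (hY : ∀ i, Integrable (Y i) (P i)) (h : Tendsto (fun i => ∫ ω, |Y i ω - c| ∂P i) l (𝓝 0)) :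
    TendstoInDistribution Y l (fun y : ℝ => y) P (Measure.dirac c) where
  forall_aemeasurable i := (hY i).aemeasurable
  tendsto := by
    refine tendsto_iff_forall_lipschitz_integral_tendsto.2 ?_
    rintro f ⟨C, hC⟩ ⟨L, hL⟩
    simp only [ProbabilityMeasure.coe_mk, Measure.map_id', integral_dirac]
    rw [tendsto_iff_norm_sub_tendsto_zero]
    refine squeeze_zero (fun _ => norm_nonneg _) (fun i => ?_)
      (by simpa only [mul_zero] using h.const_mul (L : ℝ))
    have hf : Integrable (fun ω => f (Y i ω)) (P i) := by
      refine .of_bound (hL.continuous.comp_aestronglyMeasurable (hY i).1) (|f 0| + C) ?_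
      refine ae_of_all _ fun ω => ?_
      have h1 := hC (Y i ω) 0
      rw [Real.dist_eq] at h1
      have h2 := abs_sub_abs_le_abs_sub (f (Y i ω)) (f 0)
      rw [Real.norm_eq_abs]
      linarith
    calc ‖∫ y, f y ∂(P i).map (Y i) - f c‖ = ‖∫ ω, (f (Y i ω) - f c) ∂P i‖ := by
          rw [integral_map (hY i).aemeasurable hL.continuous.aestronglyMeasurable,
            integral_sub hf (integrable_const _), integral_const, probReal_univ, one_smul]
      _ ≤ ∫ ω, L * |Y i ω - c| ∂P i :=
          norm_integral_le_of_norm_le (((hY i).sub (integrable_const c)).abs.const_mul _)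
            (ae_of_all _ fun ω => by
              simpa only [Real.dist_eq, Real.norm_eq_abs] using hL.dist_le_mul (Y i ω) c)
      _ = L * ∫ ω, |Y i ω - c| ∂P i := integral_const_mul _ _

end ConvergenceInDistribution

section UniformPermutations

lemma eq_uniformOn_of_measure_singleton_eq {E : Type*} [Finite E] [MeasurableSpace E]
    [MeasurableSingletonClass E] {ν : Measure E} [IsProbabilityMeasure ν] {s : Set E}
    (hs : ν sᶜ = 0) (h : ∀ x ∈ s, ∀ y ∈ s, ν {x} = ν {y}) : ν = uniformOn s := by
  classical
  have := Fintype.ofFinite E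
  have hs1 : ν s = 1 := (prob_compl_eq_zero_iff s.toFinite.measurableSet).1 hs
  refine Measure.ext_of_singleton fun x => ?_
  by_cases hx : x ∈ s
  · have hsum : (s.toFinset.card : ENNReal) * ν {x} = 1 := by
      calc (s.toFinset.card : ENNReal) * ν {x} = ∑ y ∈ s.toFinset, ν {y} := by
            rw [Finset.sum_congr rfl fun y hy => h y (Set.mem_toFinset.1 hy) x hx,
              Finset.sum_const, nsmul_eq_mul]
        _ = 1 := by rw [sum_measure_singleton, s.coe_toFinset, hs1]
    have huni : uniformOn s {x} = 1 / s.toFinset.card := by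
      conv_lhs => rw [← s.coe_toFinset, ← Finset.coe_singleton]
      rw [uniformOn_apply_finset, Finset.inter_singleton_of_mem (Set.mem_toFinset.2 hx),
        Finset.card_singleton, Nat.cast_one]
    rw [huni]
    exact (ENNReal.eq_div_iff (by simpa [Set.eq_empty_iff_forall_notMem] using ⟨x, hx⟩)
      (ENNReal.natCast_ne_top _)).2 hsum
  · rw [measure_mono_null (Set.singleton_subset_iff.2 hx) hs, eq_comm,
      uniformOn_eq_zero_iff s.toFinite, Set.inter_singleton_eq_empty]
    exact hx

section ConjugacyClasses

variable {G : Type*} [Group G] [Finite G] [MeasurableSpace G] [DiscreteMeasurableSpace G]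

lemma eq_uniformOn_univ_of_isMulRightInvariant (ν : Measure G) [IsProbabilityMeasure ν]
    [ν.IsMulRightInvariant] : ν = uniformOn Set.univ := by
  refine eq_uniformOn_of_measure_singleton_eq (by simp) fun x _ y _ => ?_
  rw [← measure_preimage_mul_right ν (x⁻¹ * y) {y}]
  congr 1
  ext z
  simp [mul_eq_one_iff_eq_inv, ← mul_assoc]

instance isMulLeftInvariant_uniformOn_univ :
    (uniformOn (Set.univ : Set G)).IsMulLeftInvariant := by
  rw [uniformOn, ProbabilityTheory.cond, Measure.restrict_univ]
  infer_instance

lemma map_conj_uniformOn_univ (ρ : G) :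
    (uniformOn (Set.univ : Set G)).map (fun s => s * ρ * s⁻¹) = uniformOn {κ | IsConj ρ κ} := by
  have hf : Measurable fun s : G => s * ρ * s⁻¹ := .of_discrete
  have := Measure.isProbabilityMeasure_map (μ := uniformOn (Set.univ : Set G)) hf.aemeasurable
  refine eq_uniformOn_of_measure_singleton_eq ?_ fun κ hκ κ' hκ' => ?_
  · rw [Measure.map_apply hf .of_discrete, ← measure_empty (μ := uniformOn (Set.univ : Set G))]
    congr 1
    ext s
    simp [isConj_iff]
  · obtain ⟨g, rfl⟩ := isConj_iff.1 (IsConj.trans (IsConj.symm hκ) hκ')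
    rw [Measure.map_apply hf .of_discrete, Measure.map_apply hf .of_discrete,
      ← measure_preimage_mul _ g⁻¹]
    congr 1
    ext s
    simp only [Set.mem_preimage, Set.mem_singleton_iff]
    have hconj : g⁻¹ * s * ρ * (g⁻¹ * s)⁻¹ = g⁻¹ * (s * ρ * s⁻¹) * g := by group
    rw [hconj, mul_assoc, inv_mul_eq_iff_eq_mul, ← eq_mul_inv_iff_mul_eq]

end ConjugacyClasses

lemma ae_injective_pi {ι α : Type*} [Fintype ι] [MeasurableSpace α] [MeasurableEq α]
    (μ : ι → Measure α) [∀ i, IsProbabilityMeasure (μ i)] [∀ i, NullSingletonClass (μ i)] :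
    ∀ᵐ x ∂Measure.pi μ, Function.Injective x := by
  have hne : ∀ i j, i ≠ j → ∀ᵐ x ∂Measure.pi μ, x i ≠ x j := fun i j hij => by
    have hprod : (Measure.pi μ).map (fun x => (x i, x j)) = (μ i).prod (μ j) := by
      have h := (iIndepFun_pi (μ := μ) (X := fun _ => id) fun _ => aemeasurable_id).indepFun hij
      simpa only [id, (measurePreserving_eval μ _).map_eq] using
        (indepFun_iff_map_prod_eq_prod_map_map (measurable_pi_apply i).aemeasurable
          (measurable_pi_apply j).aemeasurable).1 h
    have hdiag : (μ i).prod (μ j) (Set.diagonal α) = 0 := by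
      refine (Measure.measure_prod_null measurableSet_diagonal).2 (ae_of_all _ fun a => ?_)
      exact (Set.countable_singleton a).mono (fun b hb => (Eq.symm hb)) |>.measure_zero _
    rw [← hprod, Measure.map_apply (by fun_prop) measurableSet_diagonal] at hdiag
    exact measure_eq_zero_iff_ae_notMem.1 hdiag
  filter_upwards [ae_all_iff.2 fun i => ae_all_iff.2 fun j =>
    Filter.eventually_imp_distrib_left.2 (hne i j)] with x hx i j hij
  exact not_imp_not.1 (hx i j) hij

section Rank

variable {n : ℕ} {α : Type*} [LinearOrder α]

/-- The rank permutation of a tuple with distinct entries: `rankPerm x i` is the number of entries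
of `x` smaller than `x i`. Ties are broken by the index. -/
def rankPerm (x : Fin n → α) : Equiv.Perm (Fin n) := (Tuple.sort x)⁻¹

lemma rankPerm_lt_iff {x : Fin n → α} (hx : Function.Injective x) (i j : Fin n) :
    rankPerm x i < rankPerm x j ↔ x i < x j := by
  have hm : StrictMono (x ∘ Tuple.sort x) :=
    (Tuple.monotone_sort x).strictMono_of_injective (hx.comp (Tuple.sort x).injective)
  rw [← hm.lt_iff_lt]
  simp [rankPerm]

lemma rankPerm_comp {x : Fin n → α} (hx : Function.Injective x) (g : Equiv.Perm (Fin n)) :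
    rankPerm (x ∘ g) = rankPerm x * g := by
  have h : g * Tuple.sort (x ∘ g) = Tuple.sort x :=
    Tuple.eq_sort_iff.2 ⟨Tuple.monotone_sort (x ∘ g), fun i j hij h =>
      absurd (hx h) ((g * Tuple.sort (x ∘ g)).injective.ne hij.ne)⟩
  rw [rankPerm, rankPerm, ← h, mul_inv_rev, inv_mul_cancel_right]

variable [TopologicalSpace α] [OrderClosedTopology α] [SecondCountableTopology α]
  [MeasurableSpace α] [OpensMeasurableSpace α]

lemma measurable_rankPerm : Measurable (rankPerm : (Fin n → α) → Equiv.Perm (Fin n)) := by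
  refine measurable_to_countable' fun s => ?_
  have hs : rankPerm ⁻¹' {s} = {x : Fin n → α | (∀ i j, i ≤ j → x (s⁻¹ i) ≤ x (s⁻¹ j)) ∧
      ∀ i j, i < j → x (s⁻¹ i) = x (s⁻¹ j) → s⁻¹ i < s⁻¹ j} := by
    ext x
    rw [Set.mem_preimage, Set.mem_singleton_iff, rankPerm, inv_eq_iff_eq_inv, eq_comm,
      Tuple.eq_sort_iff]
    rfl
  rw [hs]
  have hev : ∀ i, Measurable fun x : Fin n → α => x i := measurable_pi_apply
  have hle : ∀ i j, Measurable fun x : Fin n → α => x i ≤ x j := fun i j =>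
    measurableSet_setOfPred.1 (measurableSet_le (hev i) (hev j))
  have heq : ∀ i j, Measurable fun x : Fin n → α => x i = x j := fun i j => by
    simpa only [le_antisymm_iff] using (hle i j).and (hle j i)
  refine measurableSet_setOfPred.2 (Measurable.and ?_ ?_)
  · exact .forall fun i => .forall fun j => measurable_const.imp (hle _ _)
  · exact .forall fun i => .forall fun j => measurable_const.imp ((heq _ _).imp measurable_const)

theorem map_rankPerm_pi (μ : Measure α) [IsProbabilityMeasure μ] [NullSingletonClass μ] :
    (Measure.pi fun _ : Fin n => μ).map rankPerm = uniformOn Set.univ := by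
  have := Measure.isProbabilityMeasure_map (μ := Measure.pi fun _ : Fin n => μ)
    measurable_rankPerm.aemeasurable
  have : ((Measure.pi fun _ : Fin n => μ).map rankPerm).IsMulRightInvariant := ⟨fun g => by
    have hg : MeasurePreserving (fun x : Fin n → α => x ∘ g) (Measure.pi fun _ => μ)
        (Measure.pi fun _ => μ) := by
      convert measurePreserving_piCongrLeft (fun _ : Fin n => μ) g⁻¹ using 1
      funext x i
      simpa [MeasurableEquiv.coe_piCongrLeft] using
        (Equiv.piCongrLeft_apply_apply (fun _ : Fin n => α) g⁻¹ x (g i)).symm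
    rw [Measure.map_map .of_discrete measurable_rankPerm]
    conv_rhs => rw [← hg.map_eq, Measure.map_map measurable_rankPerm hg.measurable]
    refine Measure.map_congr ?_
    filter_upwards [ae_injective_pi fun _ : Fin n => μ] with x hx
    exact (rankPerm_comp hx g).symm⟩
  exact eq_uniformOn_univ_of_isMulRightInvariant _

end Rank

section CycleType

variable {n : ℕ} {t : n.Partition}

lemma IsCyclicOfType.isCyclicOfType_iff_isConj {ρ κ : Equiv.Perm (Fin n)}
    (hρ : IsCyclicOfType t ρ) : IsCyclicOfType t κ ↔ IsConj ρ κ := by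
  rw [Equiv.Perm.partition_eq_of_isConj, Nat.Partition.ext_iff, hρ, IsCyclicOfType, eq_comm]

lemma IsUniformCyclic.exists_isCyclicOfType {Ω : Type*} [MeasurableSpace Ω] {P : Measure Ω}
    [IsProbabilityMeasure P] {τ : Ω → Equiv.Perm (Fin n)} (hτ : IsUniformCyclic t τ P) :
    ∃ ρ, IsCyclicOfType t ρ := by
  by_contra! h
  have := hτ.isProbabilityMeasure_iff.1 inferInstance
  refine IsProbabilityMeasure.ne_zero (uniformOn {ρ | IsCyclicOfType t ρ}) ?_
  simp only [h, Set.ofPred_false, uniformOn_empty_meas]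

lemma map_rankPerm_conj_pi {α : Type*} [LinearOrder α] [TopologicalSpace α]
    [OrderClosedTopology α] [SecondCountableTopology α] [MeasurableSpace α]
    [OpensMeasurableSpace α] (μ : Measure α) [IsProbabilityMeasure μ] [NullSingletonClass μ]
    {ρ : Equiv.Perm (Fin n)} (hρ : IsCyclicOfType t ρ) :
    (Measure.pi fun _ : Fin n => μ).map (fun x => rankPerm x * ρ * (rankPerm x)⁻¹) =
      uniformOn {κ | IsCyclicOfType t κ} := by
  simp only [hρ.isCyclicOfType_iff_isConj]
  rw [← map_conj_uniformOn_univ, ← map_rankPerm_pi μ, Measure.map_map .of_discrete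
    measurable_rankPerm]
  rfl

end CycleType

end UniformPermutations

section Patterns

variable {n r : ℕ} {α : Type*} [LinearOrder α] {π : Equiv.Perm (Fin r)} {ρ : Equiv.Perm (Fin n)}
  {I : Finset (Fin n)}

/-- The points `(x i, x (ρ i))` of the plane, `i ∈ I`, form the pattern `π`: listed by increasing
abscissa (through `e`), their ordinates are ordered like the values of `π`. -/
def PointPattern (π : Equiv.Perm (Fin r)) (ρ : Equiv.Perm (Fin n)) (I : Finset (Fin n))
    (x : Fin n → α) : Prop :=
  ∃ e : Fin r → Fin n, (∀ j, e j ∈ I) ∧ (∀ j k, j < k → x (e j) < x (e k)) ∧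
    ∀ j k, π j > π k ↔ x (ρ (e k)) < x (ρ (e j))

lemma pointPattern_iff_inducesPattern {s : Equiv.Perm (Fin n)} {x : Fin n → α} (hI : I.card = r)
    (hs : ∀ i j, s i < s j ↔ x i < x j) :
    PointPattern π ρ I x ↔ InducesPattern (I.map s.toEmbedding) (s * ρ * s⁻¹) π := by
  have hc : (I.map s.toEmbedding).card = r := by rw [Finset.card_map, hI]
  constructor
  · rintro ⟨e, he, hmono, hpat⟩
    have hlist : (fun j => s (e j)) = (I.map s.toEmbedding).orderEmbOfFin hc :=
      Finset.orderEmbOfFin_unique hc (fun j => Finset.mem_map_of_mem s.toEmbedding (he j))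
        fun j k hjk => (hs _ _).2 (hmono j k hjk)
    refine ⟨hc, fun j k => ?_⟩
    rw [hpat, ← hs, ← hlist]
    simp
  · rintro ⟨hc, hpat⟩
    refine ⟨fun j => s⁻¹ ((I.map s.toEmbedding).orderEmbOfFin hc j), fun j => ?_, fun j k hjk => ?_,
      fun j k => ?_⟩
    · obtain ⟨i, hi, h⟩ := Finset.mem_map.1 ((I.map s.toEmbedding).orderEmbOfFin_mem hc j)
      simpa [← h] using hi
    · simpa [← hs] using hjk
    · simpa [← hs] using hpat j k

/-- The indicator of the event that the points indexed by `I` form the pattern `π`. -/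
noncomputable def patternIndicator (π : Equiv.Perm (Fin r)) (ρ : Equiv.Perm (Fin n))
    (I : Finset (Fin n)) : (Fin n → α) → ℝ :=
  {x | PointPattern π ρ I x}.indicator 1

lemma patternIndicator_mem_Icc (x : Fin n → α) : patternIndicator π ρ I x ∈ Set.Icc 0 1 :=
  ⟨Set.indicator_nonneg (fun _ _ => zero_le_one) x,
    Set.indicator_le_self' (fun _ _ => zero_le_one) x⟩

/-- The coordinates that decide whether the points indexed by `I` form a given pattern. -/
def patternSupport (ρ : Equiv.Perm (Fin n)) (I : Finset (Fin n)) : Finset (Fin n) :=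
  I ∪ I.map ρ.toEmbedding

lemma dependsOn_patternIndicator :
    DependsOn (patternIndicator π ρ I : (Fin n → α) → ℝ) (patternSupport ρ I) := fun x y hxy => by
  have h : PointPattern π ρ I x ↔ PointPattern π ρ I y := by
    refine exists_congr fun e => and_congr_right fun he => ?_
    have habs : ∀ j, x (e j) = y (e j) := fun j => hxy _ (Finset.mem_union_left _ (he j))
    have hord : ∀ j, x (ρ (e j)) = y (ρ (e j)) := fun j =>
      hxy _ (Finset.mem_union_right _ (Finset.mem_map_of_mem ρ.toEmbedding (he j)))
    simp only [habs, hord]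
  classical
  exact if_congr h rfl rfl

lemma card_patternSupport_le : (patternSupport ρ I).card ≤ 2 * I.card := by
  refine (Finset.card_union_le _ _).trans ?_
  rw [Finset.card_map, two_mul]

lemma card_filter_mem_powersetCard_le (j : Fin n) :
    ((Finset.univ.powersetCard r).filter (j ∈ ·)).card ≤ (n - 1).choose (r - 1) := by
  have hcard : (Finset.powersetCard (r - 1) (Finset.univ.erase j)).card =
      (n - 1).choose (r - 1) := by
    rw [Finset.card_powersetCard, Finset.card_erase_of_mem (Finset.mem_univ _), Finset.card_univ,
      Fintype.card_fin]
  rw [← hcard]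
  refine Finset.card_le_card_of_injOn (fun I => I.erase j) (fun I hI => ?_) fun I hI J hJ h => ?_
  · obtain ⟨hI, hj⟩ := Finset.mem_filter.1 hI
    refine Finset.mem_powersetCard.2 ⟨Finset.erase_subset_erase _ (Finset.subset_univ _), ?_⟩
    rw [Finset.card_erase_of_mem hj, (Finset.mem_powersetCard.1 hI).2]
  · rw [← Finset.insert_erase (Finset.mem_filter.1 hI).2,
      ← Finset.insert_erase (Finset.mem_filter.1 hJ).2]
    exact congrArg (insert j) h

lemma card_filter_mem_patternSupport_le (j : Fin n) :
    ((Finset.univ.powersetCard r).filter (j ∈ patternSupport ρ ·)).card ≤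
      2 * (n - 1).choose (r - 1) := by
  have hsub : (Finset.univ.powersetCard r).filter (j ∈ patternSupport ρ ·) ⊆
      (Finset.univ.powersetCard r).filter (j ∈ ·) ∪
        (Finset.univ.powersetCard r).filter (ρ⁻¹ j ∈ ·) := by
    intro I
    simp only [patternSupport, Finset.mem_union, Finset.mem_filter, ← and_or_left,
      Finset.mem_map_equiv]
    exact id
  refine (Finset.card_le_card hsub).trans ((Finset.card_union_le _ _).trans ?_)
  rw [two_mul]
  exact add_le_add (card_filter_mem_powersetCard_le _) (card_filter_mem_powersetCard_le _)

/-- The number of occurrences of the pattern `π` among the points `(x i, x (ρ i))`. -/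
noncomputable def pointCount (π : Equiv.Perm (Fin r)) (ρ : Equiv.Perm (Fin n))
    (x : Fin n → α) : ℝ :=
  ∑ I ∈ Finset.univ.powersetCard r, patternIndicator π ρ I x

lemma pointCount_eq_patternCount {s : Equiv.Perm (Fin n)} {x : Fin n → α}
    (hs : ∀ i j, s i < s j ↔ x i < x j) :
    pointCount π ρ x = patternCount π (s * ρ * s⁻¹) := by
  classical
  rw [pointCount, patternCount]
  conv_rhs => rw [← Finset.map_univ_equiv s, Finset.powersetCard_map, Finset.sum_map, Nat.cast_sum]
  refine Finset.sum_congr rfl fun I hI => ?_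
  rw [patternIndicator, Set.indicator_apply, Nat.cast_ite, Nat.cast_one, Nat.cast_zero]
  exact if_congr (pointPattern_iff_inducesPattern (Finset.mem_powersetCard.1 hI).2 hs) rfl rfl

section Measurability

variable [TopologicalSpace α] [OrderClosedTopology α] [SecondCountableTopology α]
  [MeasurableSpace α] [OpensMeasurableSpace α]

lemma measurable_patternIndicator :
    Measurable (patternIndicator π ρ I : (Fin n → α) → ℝ) := by
  have hlt : ∀ i j : Fin n, Measurable fun x : Fin n → α => x i < x j := fun i j =>
    measurableSet_setOfPred.1 (measurableSet_lt (measurable_pi_apply i) (measurable_pi_apply j))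
  refine measurable_one.indicator (measurableSet_setOfPred.2 (.exists fun e => ?_))
  exact measurable_const.and <|
    .and (.forall fun j => .forall fun k => measurable_const.imp (hlt _ _))
      (.forall fun j => .forall fun k => measurable_const.iff (hlt _ _))

lemma measurable_pointCount : Measurable (pointCount π ρ : (Fin n → α) → ℝ) :=
  Finset.measurable_sum _ fun _ _ => measurable_patternIndicator

theorem identDistrib_patternCount_pointCount {Ω : Type*} [MeasurableSpace Ω] {P : Measure Ω}
    {t : n.Partition} {τ : Ω → Equiv.Perm (Fin n)} (hτ : IsUniformCyclic t τ P)
    (hρ : IsCyclicOfType t ρ) (π : Equiv.Perm (Fin r)) (μ : Measure α) [IsProbabilityMeasure μ]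
    [NullSingletonClass μ] :
    IdentDistrib (fun ω => (patternCount π (τ ω) : ℝ)) (pointCount π ρ) P
      (Measure.pi fun _ => μ) := by
  have hrank : HasLaw (fun x : Fin n → α => rankPerm x * ρ * (rankPerm x)⁻¹)
      (uniformOn {κ | IsCyclicOfType t κ}) (Measure.pi fun _ => μ) :=
    ⟨(Measurable.of_discrete (f := fun s : Equiv.Perm (Fin n) => s * ρ * s⁻¹)).comp
      measurable_rankPerm |>.aemeasurable, map_rankPerm_conj_pi μ hρ⟩
  refine ((hτ.identDistrib hrank).comp
    (Measurable.of_discrete (f := fun κ => (patternCount π κ : ℝ)))).trans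
    (IdentDistrib.of_ae_eq measurable_pointCount.aemeasurable ?_).symm
  filter_upwards [ae_injective_pi fun _ : Fin n => μ] with x hx
  exact pointCount_eq_patternCount (rankPerm_lt_iff hx)

end Measurability

end Patterns

section NormalApproximation

variable {n r : ℕ} {π : Equiv.Perm (Fin r)}

lemma dependency_error_le_rpow {V : ℝ} (hV : 0 < V) :
    6 * (2 * r : ℕ) * (2 * (n - 1).choose (r - 1) : ℕ) ^ 2 * √(n / 2) / V ≤
      42 * ((r : ℝ) / ((r - 1).factorial : ℝ) ^ 2) * ((n : ℝ) ^ (2 * (r : ℝ) - 3 / 2) / V) := by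
  rcases r.eq_zero_or_pos with rfl | hr
  · simp
  rcases n.eq_zero_or_pos with rfl | hn
  · rw [Nat.cast_zero, zero_div, Real.sqrt_zero, mul_zero, zero_div]
    positivity
  have hn' : (0 : ℝ) < n := by exact_mod_cast hn
  have hchoose : ((n - 1).choose (r - 1) : ℝ) ≤ (n : ℝ) ^ (r - 1) / (r - 1).factorial := by
    refine (Nat.cast_le.2 (Nat.choose_le_choose _ (Nat.sub_le n 1))).trans ?_
    exact Nat.choose_le_pow_div _ _
  have hsqrt : √((n : ℝ) / 2) ≤ 7 / 8 * √n := by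
    rw [Real.sqrt_le_left (by positivity), mul_pow, Real.sq_sqrt hn'.le]
    linarith
  have hpow : (n : ℝ) ^ (2 * (r : ℝ) - 3 / 2) = ((n : ℝ) ^ (r - 1)) ^ 2 * √n := by
    rw [Real.sqrt_eq_rpow, ← pow_mul, ← Real.rpow_natCast, ← Real.rpow_add hn']
    congr 1
    push_cast [hr]
    ring
  push_cast
  calc _ ≤ 6 * (2 * r) * (2 * ((n : ℝ) ^ (r - 1) / (r - 1).factorial)) ^ 2 * (7 / 8 * √n) / V := by
        gcongr
    _ = _ := by rw [hpow]; ring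

theorem kolmogorovDist_patternCount_gaussianReal_le {Ω : Type*} [MeasurableSpace Ω] {P : Measure Ω}
    [IsProbabilityMeasure P] {t : n.Partition} {τ : Ω → Equiv.Perm (Fin n)}
    (hτ : IsUniformCyclic t τ P) (π : Equiv.Perm (Fin r))
    (hV : 0 < Var[fun ω => (patternCount π (τ ω) : ℝ); P]) :
    kolmogorovDist (P.map fun ω => ((patternCount π (τ ω) : ℝ) - ∫ ω, (patternCount π (τ ω) : ℝ) ∂P)
        / √Var[fun ω => (patternCount π (τ ω) : ℝ); P]) (gaussianReal 0 1) ≤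
      42 * ((r : ℝ) / ((r - 1).factorial : ℝ) ^ 2)
        * ((n : ℝ) ^ (2 * (r : ℝ) - 3 / 2) / Var[fun ω => (patternCount π (τ ω) : ℝ); P]) := by
  obtain ⟨ρ, hρ⟩ := hτ.exists_isCyclicOfType
  have := nullSingletonClass_gaussianReal (μ := 0) one_ne_zero
  have hX := identDistrib_patternCount_pointCount hτ hρ π (gaussianReal 0 1)
  rw [hX.variance_eq] at hV ⊢
  rw [hX.integral_eq]
  have hmap := (hX.comp ((measurable_id.sub_const
    (∫ x, pointCount π ρ x ∂(Measure.pi fun _ => gaussianReal 0 1))).div_const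
      √Var[pointCount π ρ; Measure.pi fun _ => gaussianReal 0 1])).map_eq
  refine (congrArg (kolmogorovDist · _) hmap).trans_le ?_
  refine le_trans ?_ (dependency_error_le_rpow hV)
  have hbound := kolmogorovDist_sum_gaussianReal_le_of_dependsOn (F := pointCount π ρ)
    (fun I _ => measurable_patternIndicator) (fun I _ => patternIndicator_mem_Icc)
    (fun I _ => dependsOn_patternIndicator)
    (fun I hI => card_patternSupport_le.trans_eq (by rw [(Finset.mem_powersetCard.1 hI).2]))
    card_filter_mem_patternSupport_le (fun _ => rfl) hV
  rwa [Fintype.card_fin] at hbound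

end NormalApproximation

section Asymptotics

open scoped Topology

section Growth

variable {V : ℕ → ℝ} {p q c σ : ℝ}

lemma tendsto_div_rpow_of_isLittleO (h : (fun n : ℕ => V n - c * (n : ℝ) ^ p)
    =o[atTop] fun n : ℕ => (n : ℝ) ^ p) :
    Tendsto (fun n : ℕ => V n / (n : ℝ) ^ p) atTop (𝓝 c) := by
  have hlim := h.tendsto_div_nhds_zero.add_const c
  rw [zero_add] at hlim
  refine hlim.congr' ?_
  filter_upwards [eventually_gt_atTop 0] with n hn
  have : (n : ℝ) ^ p ≠ 0 := (Real.rpow_pos_of_pos (Nat.cast_pos.2 hn) _).ne'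
  field_simp
  ring

lemma tendsto_sqrt_div_rpow (hσ : 0 ≤ σ)
    (h : Tendsto (fun n : ℕ => V n / (n : ℝ) ^ (2 * p)) atTop (𝓝 (σ ^ 2))) :
    Tendsto (fun n : ℕ => √(V n) / (n : ℝ) ^ p) atTop (𝓝 σ) := by
  rw [← Real.sqrt_sq hσ]
  refine h.sqrt.congr fun n => ?_
  rw [mul_comm, Real.rpow_mul n.cast_nonneg, Real.rpow_two, Real.sqrt_div' _ (sq_nonneg _),
    Real.sqrt_sq (by positivity)]

lemma isBigO_rpow_div (hc : c ≠ 0)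
    (h : Tendsto (fun n : ℕ => V n / (n : ℝ) ^ p) atTop (𝓝 c)) :
    (fun n : ℕ => (n : ℝ) ^ q / V n) =O[atTop] fun n : ℕ => (n : ℝ) ^ (q - p) := by
  have hinv : (fun n : ℕ => (V n / (n : ℝ) ^ p)⁻¹) =O[atTop] fun _ => (1 : ℝ) :=
    (h.inv₀ hc).isBigO_one ℝ
  refine ((isBigO_refl (fun n : ℕ => (n : ℝ) ^ (q - p)) atTop).mul hinv).congr' ?_ (by simp)
  filter_upwards [eventually_gt_atTop 0] with n hn
  have : (n : ℝ) ^ p ≠ 0 := (Real.rpow_pos_of_pos (Nat.cast_pos.2 hn) _).ne'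
  rw [Real.rpow_sub (Nat.cast_pos.2 hn), inv_div, div_mul_div_cancel₀ this]

lemma eventually_pos_of_tendsto_div_rpow (hc : 0 < c)
    (h : Tendsto (fun n : ℕ => V n / (n : ℝ) ^ p) atTop (𝓝 c)) : ∀ᶠ n in atTop, 0 < V n := by
  filter_upwards [h.eventually_const_lt hc] with n hn
  by_contra! hV
  exact hn.not_ge (div_nonpos_of_nonpos_of_nonneg hV (by positivity))

end Growth

variable {r : ℕ} {t : ∀ n : ℕ, n.Partition} {Ω : ℕ → Type*} [∀ n, MeasurableSpace (Ω n)]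
  {P : ∀ n, Measure (Ω n)} [∀ n, IsProbabilityMeasure (P n)]
  {τ : ∀ n, Ω n → Equiv.Perm (Fin n)} {π : Equiv.Perm (Fin r)} {σ : ℝ}

theorem isBigO_kolmogorovDist_patternCount (hτ : ∀ n, IsUniformCyclic (t n) (τ n) (P n))
    (hσ : 0 < σ)
    (hV : Tendsto (fun n : ℕ => Var[fun ω => (patternCount π (τ n ω) : ℝ); P n] /
      (n : ℝ) ^ (2 * (r : ℝ) - 1)) atTop (𝓝 (σ ^ 2))) :
    (fun n => kolmogorovDist ((P n).map fun ω =>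
        ((patternCount π (τ n ω) : ℝ) - ∫ ω, (patternCount π (τ n ω) : ℝ) ∂P n) /
          √Var[fun ω => (patternCount π (τ n ω) : ℝ); P n]) (gaussianReal 0 1))
      =O[atTop] fun n : ℕ => (n : ℝ) ^ (-(1 / 2) : ℝ) := by
  have hrate := isBigO_rpow_div (q := 2 * (r : ℝ) - 3 / 2) (pow_pos hσ 2).ne' hV
  rw [show 2 * (r : ℝ) - 3 / 2 - (2 * (r : ℝ) - 1) = -(1 / 2) by ring] at hrate
  refine IsBigO.trans (.of_bound (42 * ((r : ℝ) / ((r - 1).factorial : ℝ) ^ 2)) ?_) hrate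
  filter_upwards [eventually_pos_of_tendsto_div_rpow (pow_pos hσ 2) hV] with n hn
  rw [Real.norm_of_nonneg (kolmogorovDist_nonneg _ _),
    Real.norm_of_nonneg (div_nonneg (by positivity) hn.le)]
  exact kolmogorovDist_patternCount_gaussianReal_le (hτ n) π hn

lemma IsUniformCyclic.memLp_patternCount {n : ℕ} {t : n.Partition} {Ω : Type*} [MeasurableSpace Ω]
    {P : Measure Ω} [IsFiniteMeasure P] {τ : Ω → Equiv.Perm (Fin n)} (hτ : IsUniformCyclic t τ P)
    (π : Equiv.Perm (Fin r)) : MemLp (fun ω => (patternCount π (τ ω) : ℝ)) 2 P := by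
  obtain ⟨C, hC⟩ := Finite.bddAbove_range fun κ : Equiv.Perm (Fin n) => (patternCount π κ : ℝ)
  refine .of_bound ((Measurable.of_discrete (f := fun κ => (patternCount π κ : ℝ))
    ).comp_aemeasurable hτ.aemeasurable).aestronglyMeasurable C (ae_of_all _ fun ω => ?_)
  rw [Real.norm_of_nonneg (Nat.cast_nonneg _)]
  exact hC ⟨τ ω, rfl⟩

theorem tendstoInDistribution_patternCount (hτ : ∀ n, IsUniformCyclic (t n) (τ n) (P n))
    (hσ : 0 ≤ σ)
    (hV : Tendsto (fun n : ℕ => Var[fun ω => (patternCount π (τ n ω) : ℝ); P n] /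
      (n : ℝ) ^ (2 * (r : ℝ) - 1)) atTop (𝓝 (σ ^ 2))) :
    TendstoInDistribution (fun n ω =>
      ((patternCount π (τ n ω) : ℝ) - ∫ ω, (patternCount π (τ n ω) : ℝ) ∂P n) /
        (n : ℝ) ^ ((r : ℝ) - 1 / 2)) atTop (fun y : ℝ => y) P
      (gaussianReal 0 (σ ^ 2).toNNReal) := by
  have hX : ∀ n, MemLp (fun ω => (patternCount π (τ n ω) : ℝ)) 2 (P n) := fun n =>
    (hτ n).memLp_patternCount π
  have hY : ∀ n, Integrable (fun ω =>
      (patternCount π (τ n ω) : ℝ) - ∫ ω, (patternCount π (τ n ω) : ℝ) ∂P n) (P n) := fun n =>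
    ((hX n).integrable one_le_two).sub (integrable_const _)
  have hsd : Tendsto (fun n : ℕ => √Var[fun ω => (patternCount π (τ n ω) : ℝ); P n] /
      (n : ℝ) ^ ((r : ℝ) - 1 / 2)) atTop (𝓝 σ) :=
    tendsto_sqrt_div_rpow hσ (by simpa only [mul_sub, mul_one_div_cancel (two_ne_zero' ℝ)] using hV)
  rcases hσ.eq_or_lt with rfl | hσ
  · simp only [zero_pow two_ne_zero, Real.toNNReal_zero, gaussianReal_zero_var]
    refine tendstoInDistribution_dirac_of_tendsto_integral_abs_sub
      (fun n => (hY n).div_const _) (squeeze_zero (fun n => by positivity) (fun n => ?_) hsd)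
    simp only [sub_zero, abs_div]
    rw [integral_div, abs_of_nonneg (by positivity : (0 : ℝ) ≤ (n : ℝ) ^ ((r : ℝ) - 1 / 2))]
    exact div_le_div_of_nonneg_right (integral_abs_sub_integral_le_sqrt_variance (hX n))
      (by positivity)
  · refine tendstoInDistribution_div_of_tendsto_kolmogorovDist (fun n => (hY n).aemeasurable)
      ?_ hσ hsd ?_
    · filter_upwards [eventually_gt_atTop 0] with n hn
      exact Real.rpow_pos_of_pos (Nat.cast_pos.2 hn) _
    · exact (isBigO_kolmogorovDist_patternCount hτ hσ hV).trans_tendsto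
        ((tendsto_rpow_neg_atTop one_half_pos).comp tendsto_natCast_atTop_atTop)

end Asymptotics

theorem mainTheorem7
    (r : ℕ) (hr : 1 ≤ r) (π : Equiv.Perm (Fin r))
    (t : ∀ n : ℕ, n.Partition)
    {Ω : ℕ → Type*} [∀ n, MeasurableSpace (Ω n)]
    (P : ∀ n, Measure (Ω n)) [∀ n, IsProbabilityMeasure (P n)]
    (τ : ∀ n, Ω n → Equiv.Perm (Fin n))
    (hτ : ∀ n, IsUniformCyclic (t n) (τ n) (P n))
    (X : ∀ n, Ω n → ℝ) (hX : ∀ n ω, X n ω = (patternCount π (τ n ω) : ℝ))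
    (m V : ℕ → ℝ) (hm : ∀ n, m n = ∫ ω, X n ω ∂(P n)) (hV : ∀ n, V n = variance (X n) (P n)) :
    (∀ n, 0 < V n →
      kolmogorovDist ((P n).map fun ω => (X n ω - m n) / √(V n)) (gaussianReal 0 1) ≤
        42 * ((r : ℝ) / ((r - 1).factorial : ℝ) ^ 2)
            * ((n : ℝ) ^ (2 * (r : ℝ) - 3 / 2) / V n)
          + 72 * ((r : ℝ) / ((r - 1).factorial : ℝ) ^ 3)
            * ((n : ℝ) ^ (3 * (r : ℝ) - 2) / V n ^ (3 / 2 : ℝ))) ∧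
    (∀ σ : ℝ, 0 ≤ σ →
      (fun n : ℕ => V n - σ ^ 2 * (n : ℝ) ^ (2 * (r : ℝ) - 1))
        =o[atTop] (fun n : ℕ => (n : ℝ) ^ (2 * (r : ℝ) - 1)) →
      TendstoInDistribution
          (fun n ω => (X n ω - m n) / (n : ℝ) ^ ((r : ℝ) - 1 / 2))
          atTop (fun y : ℝ => y) P (gaussianReal 0 (σ ^ 2).toNNReal) ∧
      (0 < σ →
        (fun n : ℕ =>
          kolmogorovDist ((P n).map fun ω => (X n ω - m n) / √(V n)) (gaussianReal 0 1))
          =O[atTop] (fun n : ℕ => (n : ℝ) ^ (-(1 / 2) : ℝ)))) := by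
  obtain rfl : X = fun n ω => (patternCount π (τ n ω) : ℝ) := funext₂ hX
  obtain rfl := funext hm
  obtain rfl := funext hV
  refine ⟨fun n hn => ?_, fun σ hσ ho => ?_⟩
  · refine (kolmogorovDist_patternCount_gaussianReal_le (hτ n) π hn).trans
      (le_add_of_nonneg_right ?_)
    positivity
  · have hlim := tendsto_div_rpow_of_isLittleO ho
    exact ⟨tendstoInDistribution_patternCount hτ hσ hlim,
      fun hσ' => isBigO_kolmogorovDist_patternCount hτ hσ' hlim⟩
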